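/- Let \(p\) be a prime, \(k\) an algebraically closed field of characteristic \(p\), and \(G=\mathrm{SL}_2(\mathbb F_p)\). All \(kG\)-modules are finite-dimensional. For \(n\ge 1\) let \(V_n\) be the \(n\)-dimensional \(kG\)-module of homogeneous polynomials of degree \(n-1\) in \(k[X,Y]\), on which \(\begin{pmatrix}a&b\\c&d\end{pmatrix}\) acts by \(f(X,Y)\mapsto f(aX+cY,\,bX+dY)\). Fix \(n\) with \(2\le n\le p-2\), and a function \(w\) assigning a positive real weight to each isomorphism class of non-projective indecomposable \(kG\)-modules. The non-projective summand random walk is the Markov chain on isomorphism classes of non-projective indecomposable \(kG\)-modules, started in a simple module, whose probability of a step from \(U\) to \(M\) is \[ Q_{U,M}=\frac{w(M)\,[U\otimes V_n:M]}{\sum_{L} w(L)\,[U\otimes V_n:L]}, \] where the sum is over all isomorphism classes of non-projective indecomposable modules \(L\), and \([W:L]\) is the multiplicity of \(L\) as an indecomposable direct summand of \(W\). Then \(Q\) restricts to a Markov chain on the set of isomorphism classes of simple non-projective \(kG\)-modules (from such a module the transition probabilities are well defined, sum to \(1\), and vanish outside this set); these classes are the states of the walk. Call a state even or odd according to the parity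 of its dimension. (a) If \(n\) is odd, then the walk is reducible: the even states and the odd states are each closed under the walk, and the restriction of the walk to the even states and its restriction to the odd states are each irreducible and aperiodic. (b) If \(n\) is even, then the walk is irreducible and periodic with period \(2\). Here a chain is irreducible if it has at least one state and every state can be reached from every state with positive probability; the period of a state is the greatest common divisor of the times \(t\ge1\) at which a return to it has positive probability; a chain has period \(d\) if all its states do, and is aperiodic if it has period \(1\). -/

import Mathlib

universe u v

open scoped MonoidAlgebra

noncomputable section

namespace SL2Walk

section Modules

/-- A module is indecomposable if it is nonzero and is not the direct sum of two nonzero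
submodules. -/
def IsIndecomposable (R : Type u) [Ring R] (M : Type v) [AddCommGroup M] [Module R M] : Prop :=
  Nontrivial M ∧ ∀ A B : Submodule R M, IsCompl A B → A = ⊥ ∨ B = ⊥

/-- The multiplicity of `M` as a direct summand of `W`: the largest `m` such that `W` has a direct
summand isomorphic to the direct sum of `m` copies of `M`. For `M` indecomposable this is the
number of summands isomorphic to `M` in a decomposition of `W` into indecomposable modules. -/
def multiplicity (R : Type u) [Ring R] (M W : Type v) [AddCommGroup M] [Module R M]
    [AddCommGroup W] [Module R W] : ℕ :=
  sSup {m : ℕ | ∃ A B : Submodule R W, IsCompl A B ∧ Nonempty ((Fin m → M) ≃ₗ[R] A)}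

end Modules

section Markov

variable {α : Type u}

/-- `P` restricts to a Markov chain on the set of states `S`: from each state of `S` the transition
probabilities are nonnegative, sum to `1`, and vanish outside `S`. -/
structure IsChainOn (P : α → α → ℝ) (S : Set α) : Prop where
  nonneg : ∀ x ∈ S, ∀ y, 0 ≤ P x y
  hasSum : ∀ x ∈ S, HasSum (P x) 1
  closed : ∀ x ∈ S, ∀ y, y ∉ S → P x y = 0

/-- The transition matrix restricted to the states in `S`. -/
def restrict (P : α → α → ℝ) (S : Set α) : S → S → ℝ :=
  fun x y => P x y

open Classical in
/-- The `t`-step transition probabilities. -/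
def stepProb (P : α → α → ℝ) : ℕ → α → α → ℝ
  | 0, x, y => if x = y then 1 else 0
  | t + 1, x, y => ∑' z, P x z * stepProb P t z y

/-- The chain has at least one state, and every state can be reached from every state. -/
def IsIrreducible (P : α → α → ℝ) : Prop :=
  Nonempty α ∧ ∀ x y, ∃ t, 0 < stepProb P t x y

/-- The period of a state: the greatest common divisor of the times `t ≥ 1` at which a return to it
has positive probability (and `0` if there is no such time). -/
def period (P : α → α → ℝ) (x : α) : ℕ :=
  sSup {d : ℕ | ∀ t, 1 ≤ t → 0 < stepProb P t x x → d ∣ t}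

/-- Every state has period `d`. -/
def HasPeriod (P : α → α → ℝ) (d : ℕ) : Prop :=
  ∀ x, period P x = d

/-- Every state has period `1`. -/
def IsAperiodic (P : α → α → ℝ) : Prop :=
  HasPeriod P 1

end Markov

section Representations

/-- The group `SL₂(𝔽_p)`. -/
abbrev G (p : ℕ) : Type := Matrix.SpecialLinearGroup (Fin 2) (ZMod p)

variable (k : Type u) [Field k] (p : ℕ)

section Action

variable [CharP k p]

/-- The substitution `f(X, Y) ↦ f(aX + cY, bX + dY)` attached to the matrix `(a b; c d)`, where
`X` and `Y` are the variables number `0` and `1`. -/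
def subst (g : G p) : MvPolynomial (Fin 2) k →ₐ[k] MvPolynomial (Fin 2) k :=
  MvPolynomial.aeval fun j => ∑ i, MvPolynomial.C (ZMod.castHom dvd_rfl k (g.1 i j)) *
    MvPolynomial.X i

/-- The action of `SL₂(𝔽_p)` on `k[X, Y]` by substitution. -/
def polyRep : Representation k (G p) (MvPolynomial (Fin 2) k) where
  toFun g := (subst k p g).toLinearMap
  map_one' := by
    have h : subst k p 1 = AlgHom.id k _ := by
      ext j : 1
      fin_cases j <;> simp [subst, Fin.sum_univ_two]
    rw [h]; rfl
  map_mul' g h := by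
    have h' : subst k p (g * h) = (subst k p g).comp (subst k p h) := by
      ext j : 1
      simp only [subst, AlgHom.comp_apply, MvPolynomial.aeval_X, Fin.sum_univ_two, map_add,
        map_mul, Matrix.SpecialLinearGroup.coe_mul, Matrix.mul_apply, MvPolynomial.algHom_C,
        MvPolynomial.algebraMap_eq]
      ring
    rw [h']; rfl

theorem polyRep_mem (d : ℕ) (g : G p) :
    MvPolynomial.homogeneousSubmodule (Fin 2) k d ≤
      (MvPolynomial.homogeneousSubmodule (Fin 2) k d).comap (polyRep k p g) := by
  intro f hf
  have hf' : f.IsHomogeneous d := hf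
  have := hf'.aeval (fun j => ∑ i, MvPolynomial.C (ZMod.castHom dvd_rfl k (g.1 i j)) *
    MvPolynomial.X (R := k) i) (n := 1) (fun j => MvPolynomial.IsHomogeneous.sum _ _ _
      (fun i _ => MvPolynomial.isHomogeneous_C_mul_X _ i))
  rw [one_mul] at this
  exact this

/-- For `n ≥ 1`, the `n`-dimensional representation `V_n` of `SL₂(𝔽_p)` on the homogeneous
polynomials of degree `n - 1` in `X` and `Y`. -/
def V (n : ℕ) : Representation k (G p) (MvPolynomial.homogeneousSubmodule (Fin 2) k (n - 1)) :=
  (polyRep k p).subrepresentation _ (polyRep_mem k p (n - 1))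

end Action

/-- The finite-dimensional indecomposable non-projective `kG`-modules. -/
def NonprojIndecModule : Type (u + 1) :=
  {M : Rep.{u} k (G p) // Module.Finite k M.V ∧ IsIndecomposable k[G p] M.ρ.asModule ∧
    ¬ Module.Projective k[G p] M.ρ.asModule}

/-- Isomorphism of `kG`-modules. -/
instance nonprojIndecSetoid : Setoid (NonprojIndecModule k p) where
  r M N := Nonempty (M.1.ρ.asModule ≃ₗ[k[G p]] N.1.ρ.asModule)
  iseqv :=
    { refl := fun _ => ⟨LinearEquiv.refl _ _⟩
      symm := fun ⟨e⟩ => ⟨e.symm⟩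
      trans := fun ⟨e⟩ ⟨f⟩ => ⟨e.trans f⟩ }

/-- The isomorphism classes of finite-dimensional indecomposable non-projective `kG`-modules. -/
def NonprojIndec : Type (u + 1) := Quotient (nonprojIndecSetoid k p)

variable {k p}

namespace NonprojIndec

/-- A module in the isomorphism class. All that is said about it below is invariant under
isomorphism. -/
def rep (U : NonprojIndec k p) : Rep.{u} k (G p) := (Quotient.out U).1

/-- The modules in the class are simple. -/
def IsSimple (U : NonprojIndec k p) : Prop := IsSimpleModule k[G p] U.rep.ρ.asModule

/-- The dimension over `k` of the modules in the class. -/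
def dim (U : NonprojIndec k p) : ℕ := Module.finrank k U.rep.V

/-- The multiplicity of `M` as an indecomposable summand of `U ⊗ V_n`. -/
def tensorMultiplicity [CharP k p] (n : ℕ) (U M : NonprojIndec k p) : ℕ :=
  multiplicity k[G p] M.rep.ρ.asModule (U.rep.ρ.tprod (V k p n)).asModule

end NonprojIndec

/-- The transition matrix of the non-projective summand random walk given by tensoring with `V_n`
and the weight `w`: the step from `U` to `M` has probability proportional to `w M` times the
multiplicity of `M` in `U ⊗ V_n`. -/
def transition [CharP k p] (n : ℕ) (w : NonprojIndec k p → ℝ) (U M : NonprojIndec k p) : ℝ :=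
  w M * U.tensorMultiplicity n M / ∑ᶠ L, w L * U.tensorMultiplicity n L

variable (k p)

/-- The states of the walk: the classes of simple non-projective modules. -/
def states : Set (NonprojIndec k p) := {U | U.IsSimple}

/-- The states of even dimension. -/
def evenStates : Set (NonprojIndec k p) := {U | U.IsSimple ∧ Even U.dim}

/-- The states of odd dimension. -/
def oddStates : Set (NonprojIndec k p) := {U | U.IsSimple ∧ Odd U.dim}

end Representations

end SL2Walk

end

/-! Write S_d for the binary forms of degree d, so that V_n is S_{n-1}. The simple modules are the
S_d with d < p (`exists_equiv_formRep`). The Steinberg module S_{p-1} is projective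
(`isTraceProjective_formRep`), while for d + 1 < p the dimension of S_d is prime to p, so S_d is not
projective. The states are therefore S_0, ..., S_{p-2}.

The walk stays among them. If p does not divide d + 2, then S_{d+1} ⊗ S_1 splits as S_{d+2} ⊕ S_d.
Moreover S_{n+1} is a summand of S_n ⊗ S_1 for n + 1 < p, and projectives form a tensor ideal;
induction on n gives `hasSimpleSummands_tprod`. The weights are positive, so only the support of the
multiplicities matters. The central element -1 acts on S_d by (-1)^d, hence a step changes the
parity of the dimension exactly when n is even (`even_dim_iff`).

Connectivity comes from pairs of steps. A nonprojective S_e that is a summand of S_d ⊗ (S_{n-1} ⊗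
S_{n-1}) is reached from S_d in two steps: by associativity it lies in L ⊗ S_{n-1} for an
indecomposable summand L of S_d ⊗ S_{n-1}, and L is nonprojective because S_e is
(`exists_common_summand`). The square S_{n-1} ⊗ S_{n-1} contains S_0, because n is nonzero in k, and
S_2, because a certain trace equals -(2/3)(n-1)n(n+1), which is nonzero for 2 ≤ n ≤ p - 2. The
summand S_0 gives a return in two steps, and S_2 gives the moves from d to d ± 2. So states of equal
parity are joined by paths of even length.

For n odd, one step followed by an even path back is a return of odd length, whence aperiodicity on
each parity class. For n even, parity alternates, so all returns are even and the period is 2; one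
step followed by an even path joins states of opposite parity. -/

open scoped TensorProduct

noncomputable section

namespace SL2Walk

section

open Representation

/-! ### Fitting's lemma -/

section Fitting

/-- For large n the module is the direct sum of the kernel and the range of f ^ n, and
indecomposability kills one of them. -/
theorem End.isUnit_or_isNilpotent {R M : Type*} [Ring R] [AddCommGroup M] [Module R M]
    [IsNoetherian R M] [IsArtinian R M] (hM : IsIndecomposable R M) (f : Module.End R M) :
    IsUnit f ∨ IsNilpotent f := by
  obtain ⟨n, hn, hpos⟩ :=
    (f.eventually_isCompl_ker_pow_range_pow.and (Filter.eventually_gt_atTop 0)).exists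
  rcases hM.2 _ _ hn with h | h
  · left
    have h2 : LinearMap.range (f ^ n) = ⊤ := by
      have := hn.sup_eq_top
      rwa [h, bot_sup_eq] at this
    rw [← isUnit_pow_iff hpos.ne', Module.End.isUnit_iff]
    exact ⟨LinearMap.ker_eq_bot.1 h, LinearMap.range_eq_top.1 h2⟩
  · right
    exact ⟨n, LinearMap.range_eq_bot.1 h⟩

/-- The endomorphism ring is local: if f is nilpotent then 1 - f is a unit. This replaces the
Krull–Schmidt theorem throughout. -/
theorem End.bijective_or_bijective_of_add_eq_one {R M : Type*} [Ring R] [AddCommGroup M]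
    [Module R M] [IsNoetherian R M] [IsArtinian R M] (hM : IsIndecomposable R M)
    (f g : Module.End R M) (h : f + g = 1) : Function.Bijective f ∨ Function.Bijective g := by
  rcases End.isUnit_or_isNilpotent hM f with hf | hf
  · exact .inl ((Module.End.isUnit_iff f).1 hf)
  · right
    rw [← Module.End.isUnit_iff, eq_sub_of_add_eq' h]
    exact hf.isUnit_one_sub

end Fitting

/-! ### Direct summands of representations -/

section Summand

variable {k Γ A B C D : Type*} [Field k] [Group Γ]
  [AddCommMonoid A] [Module k A] [AddCommMonoid B] [Module k B] [AddCommMonoid C] [Module k C]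
  [AddCommMonoid D] [Module k D]
  {ρ : Representation k Γ A} {σ : Representation k Γ B} {τ : Representation k Γ C}
  {ν : Representation k Γ D}

/-- `ρ` is isomorphic to a direct summand of `σ`. -/
def IsSummand (ρ : Representation k Γ A) (σ : Representation k Γ B) : Prop :=
  ∃ (f : IntertwiningMap ρ σ) (g : IntertwiningMap σ ρ), g.comp f = .id ρ

theorem IsSummand.refl (ρ : Representation k Γ A) : IsSummand ρ ρ := ⟨.id ρ, .id ρ, rfl⟩

theorem IsSummand.trans (h : IsSummand ρ σ) (h' : IsSummand σ τ) : IsSummand ρ τ := by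
  obtain ⟨f, g, h⟩ := h
  obtain ⟨f', g', h'⟩ := h'
  refine ⟨f'.comp f, g.comp g', ?_⟩
  ext x
  have h1 := DFunLike.congr_fun h x
  have h2 := DFunLike.congr_fun h' (f x)
  simp only [IntertwiningMap.comp_apply, IntertwiningMap.id_apply] at h1 h2
  change g (g' (f' (f x))) = x
  rw [h2, h1]

theorem _root_.Representation.Equiv.isSummand (e : Representation.Equiv ρ σ) : IsSummand ρ σ :=
  ⟨e.toIntertwiningMap, e.symm.toIntertwiningMap, by ext x; simp⟩

theorem IsSummand.tensor (h : IsSummand ρ σ) (h' : IsSummand τ ν) :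
    IsSummand (ρ.tprod τ) (σ.tprod ν) := by
  obtain ⟨f, g, h⟩ := h
  obtain ⟨f', g', h'⟩ := h'
  refine ⟨f.tensor f', g.tensor g', ?_⟩
  ext x y
  have h1 := DFunLike.congr_fun h x
  have h2 := DFunLike.congr_fun h' y
  simp only [IntertwiningMap.comp_apply, IntertwiningMap.id_apply] at h1 h2
  change g (f x) ⊗ₜ[k] g' (f' y) = x ⊗ₜ[k] y
  rw [h2, h1]

theorem IsSummand.of_bijective (f : IntertwiningMap ρ σ) (g : IntertwiningMap σ ρ)
    (h : Function.Bijective (g.comp f)) : IsSummand ρ σ := by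
  refine ⟨f, ((g.comp f).ofBijective h).symm.toIntertwiningMap.comp g, ?_⟩
  ext x
  exact ((g.comp f).ofBijective h).symm_apply_apply x

end Summand

section GroupSummand

variable {k Γ A B C D : Type*} [Field k] [Group Γ]
  [AddCommGroup A] [Module k A] [AddCommMonoid B] [Module k B] [AddCommMonoid C] [Module k C]
  [AddCommMonoid D] [Module k D]
  {ρ : Representation k Γ A} {σ : Representation k Γ B} {τ : Representation k Γ C}
  {ν : Representation k Γ D}

theorem bijective_or_bijective_of_add_eq_id [FiniteDimensional k A]
    (hρ : IsIndecomposable k[Γ] ρ.asModule) (f g : IntertwiningMap ρ ρ) (h : f + g = .id ρ) :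
    Function.Bijective f ∨ Function.Bijective g := by
  have : IsNoetherian k[Γ] ρ.asModule := isNoetherian_of_tower k
    (inferInstanceAs (IsNoetherian k A))
  have : IsArtinian k[Γ] ρ.asModule := isArtinian_of_tower k
    (inferInstanceAs (IsArtinian k A))
  refine End.bijective_or_bijective_of_add_eq_one hρ
    (IntertwiningMap.equivAlgEnd (ρ := ρ) f) (IntertwiningMap.equivAlgEnd (ρ := ρ) g) ?_
  rw [← map_add, h]
  exact map_one _

/-- An indecomposable summand of `σ` is a summand of `τ` or of `ν` when the identity of `σ` is a
sum of two maps factoring through `τ` and `ν` respectively. -/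
theorem IsSummand.or_of_add_eq_id [FiniteDimensional k A]
    (hρ : IsIndecomposable k[Γ] ρ.asModule) (h : IsSummand ρ σ)
    (a : IntertwiningMap σ τ) (b : IntertwiningMap τ σ)
    (a' : IntertwiningMap σ ν) (b' : IntertwiningMap ν σ)
    (hab : b.comp a + b'.comp a' = .id σ) : IsSummand ρ τ ∨ IsSummand ρ ν := by
  obtain ⟨f, g, h⟩ := h
  -- Compressing the two given maps to ρ writes its identity as a sum of two endomorphisms, and
  -- Fitting's lemma makes one of them bijective.
  have key : (g.comp b).comp (a.comp f) + (g.comp b').comp (a'.comp f) = .id ρ := by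
    ext x
    have h1 := DFunLike.congr_fun h x
    have h2 := DFunLike.congr_fun hab (f x)
    simp only [IntertwiningMap.coe_add, Pi.add_apply, IntertwiningMap.comp_apply,
      IntertwiningMap.id_apply] at h1 h2 ⊢
    change (g (b (a (f x)))) + g (b' (a' (f x))) = x
    rw [← map_add, h2, h1]
  rcases bijective_or_bijective_of_add_eq_id hρ _ _ key with h | h
  · exact .inl (.of_bijective _ _ h)
  · exact .inr (.of_bijective _ _ h)

end GroupSummand

/-! ### Irreducible representations and their summands -/

section Irreducible

variable {k Γ A B : Type*} [Field k] [Group Γ]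
  [AddCommGroup A] [Module k A] [AddCommGroup B] [Module k B]
  {ρ : Representation k Γ A} {σ : Representation k Γ B}

/-- A linear isomorphism of the associated modules. -/
def asModuleEquivOfEquiv (e : Representation.Equiv ρ σ) : ρ.asModule ≃ₗ[k[Γ]] σ.asModule :=
  LinearEquiv.ofBijective (IntertwiningMap.equivLinearMapAsModule ρ σ e.toIntertwiningMap)
    e.toLinearEquiv.bijective

/-- The isomorphism of representations underlying an isomorphism of modules. -/
def equivOfAsModuleEquiv (e : ρ.asModule ≃ₗ[k[Γ]] σ.asModule) : Representation.Equiv ρ σ :=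
  ((IntertwiningMap.equivLinearMapAsModule ρ σ).symm e.toLinearMap).ofBijective e.bijective

theorem isIndecomposable_of_isIrreducible (ρ : Representation k Γ A)
    [Representation.IsIrreducible ρ] :
    IsIndecomposable k[Γ] ρ.asModule := by
  have hs : IsSimpleModule k[Γ] ρ.asModule := inferInstance
  refine ⟨IsSimpleModule.nontrivial k[Γ] ρ.asModule, fun P Q hPQ => ?_⟩
  rcases eq_bot_or_eq_top P with h | h
  · exact .inl h
  · right
    have := hPQ.inf_eq_bot
    rwa [h, top_inf_eq] at this

/-- A nonzero summand of an irreducible representation is isomorphic to it. -/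
theorem IsSummand.nonempty_equiv [Nontrivial A] [Representation.IsIrreducible σ]
    (h : IsSummand ρ σ) :
    Nonempty (Representation.Equiv ρ σ) := by
  obtain ⟨f, g, h⟩ := h
  have hf : Function.LeftInverse g f := fun x => DFunLike.congr_fun h x
  refine ⟨f.ofBijective ⟨hf.injective, ?_⟩⟩
  rcases Representation.IsIrreducible.injective_or_eq_zero g with hg | hg
  · exact fun y => ⟨g y, hg (hf (g y))⟩
  · obtain ⟨x, hx⟩ := exists_ne (0 : A)
    exact absurd (by rw [← hf x, hg]; rfl) hx

theorem isIrreducible_of_equiv [Representation.IsIrreducible σ] (e : Representation.Equiv ρ σ) :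
    Representation.IsIrreducible ρ := by
  rw [irreducible_iff_isSimpleModule_asModule]
  have e' : ρ.asModule ≃ₗ[k[Γ]] σ.asModule := asModuleEquivOfEquiv e
  have h : IsSimpleModule k[Γ] σ.asModule := inferInstance
  exact IsSimpleModule.congr (N := σ.asModule) e'

end Irreducible

/-! ### Splitting along complementary subrepresentations -/

section Decomposition

variable {k : Type*} {Γ A B D : Type*} [Field k] [Group Γ]
  [AddCommGroup A] [Module k A] [AddCommGroup B] [Module k B]
  [AddCommGroup D] [Module k D]
  {ρ : Representation k Γ A} {σ : Representation k Γ B} {ν : Representation k Γ D}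

/-- The inclusion of a subrepresentation. -/
def subtypeMap (P : Subrepresentation σ) : IntertwiningMap P.toRepresentation σ where
  toLinearMap := P.toSubmodule.subtype
  isIntertwining' _ := rfl

/-- The projection to a subrepresentation along a complement. -/
def projMap (P Q : Subrepresentation σ) (h : IsCompl P.toSubmodule Q.toSubmodule) :
    IntertwiningMap σ P.toRepresentation where
  toLinearMap := P.toSubmodule.projectionOnto Q.toSubmodule h
  isIntertwining' g := by
    ext x
    obtain ⟨y, hy, z, hz, rfl⟩ : ∃ y ∈ P.toSubmodule, ∃ z ∈ Q.toSubmodule, y + z = x :=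
      Submodule.mem_sup.1 (h.sup_eq_top ▸ Submodule.mem_top)
    have e1 := Submodule.projectionOnto_apply_left h ⟨y, hy⟩
    have e2 := Submodule.projectionOnto_apply_right h ⟨z, hz⟩
    have e3 := Submodule.projectionOnto_apply_left h ⟨_, P.apply_mem_toSubmodule g hy⟩
    have e4 := Submodule.projectionOnto_apply_right h ⟨_, Q.apply_mem_toSubmodule g hz⟩
    simp only [LinearMap.comp_apply, map_add] at e1 e2 e3 e4 ⊢
    rw [e1, e2, e3, e4]
    simp [Subrepresentation.toRepresentation]

theorem subtypeMap_comp_projMap_add (P Q : Subrepresentation σ)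
    (h : IsCompl P.toSubmodule Q.toSubmodule) :
    (subtypeMap P).comp (projMap P Q h) + (subtypeMap Q).comp (projMap Q P h.symm) = .id σ := by
  ext x
  exact Submodule.projection_add_projection_eq_self h x

theorem projMap_comp_subtypeMap (P Q : Subrepresentation σ)
    (h : IsCompl P.toSubmodule Q.toSubmodule) :
    (projMap P Q h).comp (subtypeMap P) = .id _ := by
  ext x
  exact congrArg Subtype.val (Submodule.projectionOnto_apply_left h x)

end Decomposition

/-- An indecomposable summand of `σ ⊗ ν` is a summand of `L ⊗ ν` for some indecomposable summand
`L` of `σ`. -/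
theorem IsSummand.exists_indecomposable {k : Type*} {Γ A D : Type*} [Field k] [Group Γ]
    [AddCommGroup A] [Module k A] [AddCommMonoid D] [Module k D] [FiniteDimensional k A]
    {ρ : Representation k Γ A} {ν : Representation k Γ D}
    (hρ : IsIndecomposable k[Γ] ρ.asModule)
    {B : Type v} [AddCommGroup B] [Module k B] [FiniteDimensional k B]
    (σ : Representation k Γ B) (h : IsSummand ρ (σ.tprod ν)) :
    ∃ L : Rep.{v} k Γ, FiniteDimensional k L.V ∧ IsIndecomposable k[Γ] L.ρ.asModule ∧
      IsSummand L.ρ σ ∧ IsSummand ρ (L.ρ.tprod ν) := by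
  -- Induction on the dimension of σ: a decomposable σ splits into two smaller pieces, and ρ
  -- survives in the tensor product of ν with one of them.
  induction hn : Module.finrank k B using Nat.strong_induction_on generalizing B with
  | _ n ih =>
  subst hn
  by_cases hσ : IsIndecomposable k[Γ] σ.asModule
  · exact ⟨Rep.of σ, inferInstance, hσ, .refl _, h⟩
  have hnt : Nontrivial B := by
    by_contra hB
    rw [not_nontrivial_iff_subsingleton] at hB
    obtain ⟨f, g, hfg⟩ := h
    have hA : Nontrivial A := hρ.1
    obtain ⟨x, hx⟩ := exists_ne (0 : A)
    have h1 := DFunLike.congr_fun hfg x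
    have : f x = 0 := Subsingleton.elim (α := TensorProduct k B D) _ _
    simp [this] at h1
    exact hx h1.symm
  have : ∃ P Q : Submodule k[Γ] σ.asModule, IsCompl P Q ∧ P ≠ ⊥ ∧ Q ≠ ⊥ := by
    by_contra hc
    push Not at hc
    exact hσ ⟨hnt, fun P Q h => or_iff_not_imp_left.2 (hc P Q h)⟩
  obtain ⟨P, Q, hPQ, hP, hQ⟩ := this
  set P' := Subrepresentation.ofSubmodule' P with hP'
  set Q' := Subrepresentation.ofSubmodule' Q with hQ'
  have hc : IsCompl P'.toSubmodule Q'.toSubmodule := by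
    constructor
    · rw [Submodule.disjoint_def]
      intro x hx hx'
      exact Submodule.disjoint_def.1 hPQ.1 x hx hx'
    · rw [codisjoint_iff, eq_top_iff]
      intro x _
      obtain ⟨y, hy, z, hz, hyz⟩ : ∃ y ∈ P, ∃ z ∈ Q, y + z = x :=
        Submodule.mem_sup.1 (hPQ.sup_eq_top ▸ Submodule.mem_top)
      exact Submodule.mem_sup.2 ⟨y, hy, z, hz, hyz⟩
  have hP0 : P'.toSubmodule ≠ ⊥ := by
    obtain ⟨x, hx, hx0⟩ := Submodule.exists_mem_ne_zero_of_ne_bot hP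
    exact fun h => hx0 ((Submodule.mem_bot k).1 (h ▸ (show x ∈ P'.toSubmodule from hx)))
  have hQ0 : Q'.toSubmodule ≠ ⊥ := by
    obtain ⟨x, hx, hx0⟩ := Submodule.exists_mem_ne_zero_of_ne_bot hQ
    exact fun h => hx0 ((Submodule.mem_bot k).1 (h ▸ (show x ∈ Q'.toSubmodule from hx)))
  have hdim := Submodule.finrank_add_eq_of_isCompl hc
  have hP1 := Submodule.one_le_finrank_iff.2 hP0
  have hQ1 := Submodule.one_le_finrank_iff.2 hQ0
  -- The two projections of σ, tensored with ν, sum to the identity of σ ⊗ ν.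
  have hsplit := h.or_of_add_eq_id hρ ((projMap P' Q' hc).rTensor ν) ((subtypeMap P').rTensor ν)
    ((projMap Q' P' hc.symm).rTensor ν) ((subtypeMap Q').rTensor ν) (by
      rw [← IntertwiningMap.rTensor_id, ← subtypeMap_comp_projMap_add P' Q' hc,
        IntertwiningMap.rTensor_add]
      congr 1 <;> (ext; rfl))
  rcases hsplit with hs | hs
  · obtain ⟨L, h1, h2, h3, h4⟩ := ih _ (by omega) P'.toRepresentation hs rfl
    exact ⟨L, h1, h2, h3.trans ⟨_, _, projMap_comp_subtypeMap P' Q' hc⟩, h4⟩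
  · obtain ⟨L, h1, h2, h3, h4⟩ := ih _ (by omega) Q'.toRepresentation hs rfl
    exact ⟨L, h1, h2, h3.trans ⟨_, _, projMap_comp_subtypeMap Q' P' hc.symm⟩, h4⟩

/-! ### Projectivity and Higman's criterion -/

section Higman

variable {k Γ A B : Type*} [Field k] [Group Γ] [Fintype Γ]
  [AddCommMonoid A] [Module k A] [AddCommMonoid B] [Module k B]
  {ρ : Representation k Γ A} {σ : Representation k Γ B}

/-- The identity is the sum of the conjugates of a linear endomorphism. By Higman's criterion this
is equivalent to projectivity. -/
def IsTraceProjective (ρ : Representation k Γ A) : Prop :=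
  ∃ θ : Module.End k A, ∀ x, ∑ g : Γ, ρ g (θ (ρ g⁻¹ x)) = x

/-- With θ ⊗ id in place of θ, the actions of g and its inverse cancel on the second factor. Hence
projectives form a tensor ideal. -/
theorem IsTraceProjective.tprod (h : IsTraceProjective ρ) (σ : Representation k Γ B) :
    IsTraceProjective (ρ.tprod σ) := by
  obtain ⟨θ, hθ⟩ := h
  refine ⟨TensorProduct.map θ LinearMap.id, fun x => ?_⟩
  induction x using TensorProduct.induction_on with
  | zero => simp
  | add x y hx hy => simp only [map_add, Finset.sum_add_distrib, hx, hy]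
  | tmul x y =>
    simp only [Representation.tprod_apply, TensorProduct.map_tmul, LinearMap.id_apply, self_inv_apply]
    rw [← TensorProduct.sum_tmul, hθ]

theorem IsSummand.isTraceProjective (h : IsSummand ρ σ) (hσ : IsTraceProjective σ) :
    IsTraceProjective ρ := by
  obtain ⟨f, g, h⟩ := h
  obtain ⟨θ, hθ⟩ := hσ
  refine ⟨g.toLinearMap ∘ₗ θ ∘ₗ f.toLinearMap, fun x => ?_⟩
  have h1 := DFunLike.congr_fun h x
  have h2 := congrArg g (hθ (f x))
  rw [map_sum] at h2
  refine Eq.trans (Finset.sum_congr rfl fun y _ => ?_) (h2.trans h1)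
  simp [IntertwiningMap.isIntertwining]

end Higman

section Projective

variable {k Γ A : Type*} [Field k] [Group Γ] [Fintype Γ]
  [AddCommGroup A] [Module k A]
  {ρ : Representation k Γ A}

/-- The free cover has a k-linear section s; summing the conjugates of s ∘ θ over the group gives an
equivariant section. -/
theorem IsTraceProjective.projective (h : IsTraceProjective ρ) :
    Module.Projective k[Γ] ρ.asModule := by
  obtain ⟨θ, hθ⟩ := h
  rw [Module.projective_def']
  set π := Finsupp.linearCombination k[Γ] (id : ρ.asModule → ρ.asModule) with hπ
  have hsurj : Function.Surjective π := Finsupp.linearCombination_id_surjective _ _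
  obtain ⟨s, hs⟩ := LinearMap.exists_rightInverse_of_surjective (π.restrictScalars k)
    (LinearMap.range_eq_top.2 hsurj)
  let θ' : ρ.asModule →ₗ[k] ρ.asModule := θ
  refine ⟨(s ∘ₗ θ').sumOfConjugatesEquivariant Γ, ?_⟩
  ext x
  rw [LinearMap.comp_apply, LinearMap.sumOfConjugatesEquivariant_apply, map_sum,
    LinearMap.id_apply]
  refine Eq.trans ?_ (hθ x)
  refine Fintype.sum_equiv (Equiv.inv Γ) _ _ fun g => ?_
  rw [LinearMap.conjugate_apply, map_smul]
  have : π (s (θ' (MonoidAlgebra.single g (1 : k) • x))) =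
      θ' (MonoidAlgebra.single g (1 : k) • x) := LinearMap.congr_fun hs _
  rw [LinearMap.comp_apply, this, single_smul, one_smul, single_smul, one_smul]
  simp only [Equiv.inv_apply, inv_inv]
  rfl

/-- On a free module, taking the coefficient at the identity of the group has conjugates summing to
the canonical map. Composing with an equivariant section transports this to any projective module.
-/
theorem isTraceProjective_of_projective (h : Module.Projective k[Γ] ρ.asModule) :
    IsTraceProjective ρ := by
  classical
  rw [Module.projective_def'] at h
  obtain ⟨s, hs⟩ := h
  let c : k[Γ] →ₗ[k] k := Finsupp.lapply 1 ∘ₗ (MonoidAlgebra.coeffLinearEquiv k).toLinearMap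
  let E : (ρ.asModule →₀ k[Γ]) →ₗ[k] ρ.asModule :=
    Finsupp.lsum k fun m => c.smulRight m
  have key : ∀ x : ρ.asModule →₀ k[Γ],
      ∑ g : Γ, MonoidAlgebra.single g (1 : k) • E (MonoidAlgebra.single g⁻¹ (1 : k) • x) =
        Finsupp.linearCombination k[Γ] id x := by
    intro x
    induction x using Finsupp.induction_linear with
    | zero => simp
    | add x y hx hy =>
      simp only [smul_add, map_add, Finset.sum_add_distrib, hx, hy]
    | single m a =>
      induction a using MonoidAlgebra.induction_linear with
      | zero => simp
      | add a b ha hb =>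
        simp only [Finsupp.single_add, smul_add, map_add, Finset.sum_add_distrib, ha, hb]
      | single h r =>
        rw [Finset.sum_eq_single h]
        · simp [E, c, MonoidAlgebra.single_mul_single, ← smul_assoc]
          rfl
        · intro g _ hg
          have : g⁻¹ * h ≠ 1 := fun h' => hg (inv_mul_eq_one.1 h')
          simp [E, c, MonoidAlgebra.single_mul_single, this]
        · simp
  refine ⟨E ∘ₗ s.restrictScalars k, fun (x : ρ.asModule) => ?_⟩
  have h1 := key (s x)
  rw [show Finsupp.linearCombination k[Γ] id (s x) = x from LinearMap.congr_fun hs x] at h1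
  refine Eq.trans (Finset.sum_congr rfl fun g _ => ?_) h1
  have h2 : MonoidAlgebra.single g⁻¹ (1 : k) • s x = s (ρ g⁻¹ x) := by
    refine (s.map_smul _ x).symm.trans (congrArg s ?_)
    rw [single_smul, one_smul]
    rfl
  rw [h2, single_smul, one_smul]
  rfl

/-- Take traces: each conjugate of θ has the trace of θ, so the dimension equals |Γ| tr θ in k. -/
theorem IsTraceProjective.finrank_eq_zero [FiniteDimensional k A] (h : IsTraceProjective ρ)
    (hΓ : (Fintype.card Γ : k) = 0) : (Module.finrank k A : k) = 0 := by
  obtain ⟨θ, hθ⟩ := h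
  have h1 : ∑ g : Γ, ρ g * (θ * ρ g⁻¹) = 1 := by
    ext x
    simpa [LinearMap.sum_apply] using hθ x
  have h2 := congrArg (LinearMap.trace k A) h1
  rw [map_sum, LinearMap.trace_one] at h2
  rw [← h2]
  have : ∀ g : Γ, LinearMap.trace k A (ρ g * (θ * ρ g⁻¹)) = LinearMap.trace k A θ := by
    intro g
    rw [LinearMap.trace_mul_comm, mul_assoc, ← map_mul, inv_mul_cancel, map_one, mul_one]
  simp [this, hΓ]

end Projective

/-! ### Summands detected by the trace form -/

section TraceForm

variable {k Γ A C : Type*} [Field k] [Group Γ]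
  [AddCommGroup A] [Module k A] [AddCommGroup C] [Module k C]
  {ρ : Representation k Γ A} {σ : Representation k Γ C}

/-- The map `C → End A` attached to `A ⊗ C → A`. -/
def toLinHom (b : IntertwiningMap (ρ.tprod σ) ρ) : IntertwiningMap σ (ρ.linHom ρ) where
  toLinearMap := (TensorProduct.mk k A C).flip.compr₂ b.toLinearMap
  isIntertwining' g := by
    ext c a
    have := b.isIntertwining _ _ g (ρ g⁻¹ a ⊗ₜ c)
    rw [Representation.tprod_apply, TensorProduct.map_tmul, self_inv_apply] at this
    simpa using this

theorem toLinHom_apply (b : IntertwiningMap (ρ.tprod σ) ρ) (c : C) (a : A) :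
    toLinHom b c a = b (a ⊗ₜ c) := rfl

/-- The map `End A → C*` dual to `C → End A` under the trace form. -/
def traceDual (φ : IntertwiningMap σ (ρ.linHom ρ)) : IntertwiningMap (ρ.linHom ρ) σ.dual where
  toLinearMap := (LinearMap.compr₂ (LinearMap.mul k (Module.End k A))
    (LinearMap.trace k A)).compl₂ φ.toLinearMap
  isIntertwining' g := by
    ext T c
    have h := φ.isIntertwining _ _ g⁻¹ c
    rw [linHom_apply, inv_inv] at h
    simp only [LinearMap.comp_apply, LinearMap.compl₂_apply, LinearMap.compr₂_apply,
      LinearMap.mul_apply', linHom_apply, dual_apply, Module.Dual.transpose_apply,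
      IntertwiningMap.coe_toLinearMap, h]
    change LinearMap.trace k A (ρ g * (T * ρ g⁻¹ * φ c)) =
      LinearMap.trace k A (T * ρ g⁻¹ * φ c * ρ g)
    rw [LinearMap.trace_mul_comm]

/-- An irreducible representation acting on `A` with nonzero trace form is a summand of
`End A`. -/
theorem isSummand_linHom_of_trace_ne_zero [FiniteDimensional k C]
    [Representation.IsIrreducible σ]
    (φ : IntertwiningMap σ (ρ.linHom ρ)) (c c' : C)
    (h : LinearMap.trace k A (φ c * φ c') ≠ 0) : IsSummand σ (ρ.linHom ρ) := by
  set ψ := (traceDual φ).comp φ with hψ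
  -- The composite C → End A → C* is the trace form pulled back to C. Being nonzero, it is injective
  -- by irreducibility, then bijective by dimension, and so splits φ.
  have hinj : Function.Injective ψ := by
    rcases Representation.IsIrreducible.injective_or_eq_zero ψ with h' | h'
    · exact h'
    · refine absurd ?_ h
      have := congrArg (fun f => f c c') h'
      exact this
  have hbij : Function.Bijective ψ := by
    refine ⟨hinj, ?_⟩
    exact (LinearMap.injective_iff_surjective_of_finrank_eq_finrank (f := ψ.toLinearMap)
      Subspace.dual_finrank_eq.symm).1 hinj
  refine ⟨φ, (ψ.ofBijective hbij).symm.toIntertwiningMap.comp (traceDual φ), ?_⟩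
  ext x
  exact (ψ.ofBijective hbij).symm_apply_apply x

/-- For self-dual A the representation End A ≅ A* ⊗ A becomes A ⊗ A. -/
theorem isSummand_tprod_of_trace_ne_zero [FiniteDimensional k A]
    [FiniteDimensional k C] [Representation.IsIrreducible σ]
    (e : Representation.Equiv ρ ρ.dual)
    (b : IntertwiningMap (ρ.tprod σ) ρ) (c c' : C)
    (h : LinearMap.trace k A (toLinHom b c * toLinHom b c') ≠ 0) :
    IsSummand σ (ρ.tprod ρ) :=
  ((isSummand_linHom_of_trace_ne_zero _ c c' h).trans
    (Representation.Equiv.dualTensorHom ρ ρ).symm.isSummand).trans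
      (e.symm.isSummand.tensor (.refl ρ))

end TraceForm

/-! ### Binary forms and their monomial basis -/

section Poly

variable (k : Type u) [Field k] (p : ℕ) [CharP k p]

/-- The binary forms of degree `d`. -/
abbrev Forms (d : ℕ) : Submodule k (MvPolynomial (Fin 2) k) :=
  MvPolynomial.homogeneousSubmodule (Fin 2) k d

/-- The representation of `SL₂(𝔽_p)` on binary forms of degree `d`. -/
def formRep (d : ℕ) : Representation k (G p) (Forms k d) :=
  (polyRep k p).subrepresentation _ (polyRep_mem k p d)

/-- The entries of a matrix, as elements of `k`. -/
def entry (g : G p) (i j : Fin 2) : k := ZMod.castHom dvd_rfl k (g.1 i j)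

variable {k p}

theorem formRep_apply_coe (d : ℕ) (g : G p) (f : Forms k d) :
    (formRep k p d g f : MvPolynomial (Fin 2) k) = subst k p g f := rfl

open MvPolynomial (C X pderiv)

theorem subst_X (g : G p) (j : Fin 2) :
    subst k p g (X j) = C (entry k p g 0 j) * X 0 + C (entry k p g 1 j) * X 1 := by
  simp [subst, entry, Fin.sum_univ_two]

theorem subst_C (g : G p) (c : k) : subst k p g (C c) = C c :=
  MvPolynomial.algHom_C _ _

theorem entry_det (g : G p) :
    entry k p g 0 0 * entry k p g 1 1 - entry k p g 0 1 * entry k p g 1 0 = 1 := by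
  have h := g.2
  rw [Matrix.det_fin_two] at h
  have h2 := congrArg (ZMod.castHom dvd_rfl k) h
  rw [map_sub, map_mul, map_mul, map_one] at h2
  exact h2

theorem pderiv_subst (g : G p) (f : MvPolynomial (Fin 2) k) (i : Fin 2) :
    pderiv i (subst k p g f) = C (entry k p g i 0) * subst k p g (pderiv 0 f) +
      C (entry k p g i 1) * subst k p g (pderiv 1 f) := by
  induction f using MvPolynomial.induction_on with
  | C a => simp
  | add f h hf hh => simp only [map_add, hf, hh]; ring
  | mul_X f j hf =>
    rw [map_mul, Derivation.leibniz, hf, subst_X]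
    simp only [Derivation.leibniz, map_add, smul_eq_mul, MvPolynomial.pderiv_C]
    fin_cases i <;> fin_cases j <;>
      simp [subst_X] <;> ring

/-- The exponent of `X ^ a * Y ^ b`. -/
def expo (a b : ℕ) : Fin 2 →₀ ℕ := Finsupp.single 0 a + Finsupp.single 1 b

@[simp] theorem expo_zero (a b : ℕ) : expo a b 0 = a := by simp [expo]

@[simp] theorem expo_one (a b : ℕ) : expo a b 1 = b := by simp [expo]

theorem expo_self (m : Fin 2 →₀ ℕ) : expo (m 0) (m 1) = m := by
  ext i; fin_cases i <;> simp

theorem degree_fin_two (m : Fin 2 →₀ ℕ) : m.degree = m 0 + m 1 := by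
  simp [Finsupp.degree_eq_sum, Fin.sum_univ_two]

theorem X_pow_mul_X_pow (a b : ℕ) :
    (X 0 : MvPolynomial (Fin 2) k) ^ a * X 1 ^ b = MvPolynomial.monomial (expo a b) 1 := by
  rw [MvPolynomial.X_pow_eq_monomial, MvPolynomial.X_pow_eq_monomial, MvPolynomial.monomial_mul,
    one_mul, expo]

variable (k) in
/-- The form `X ^ (d - i) * Y ^ i`, for `i ≤ d`. -/
def mono (d i : ℕ) : Forms k d :=
  -- The minimum keeps the degree equal to d even for i > d, so that the index can be any natural
  -- number.
  ⟨X 0 ^ (d - i) * X 1 ^ (min i d), by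
    have := ((MvPolynomial.isHomogeneous_X k (0 : Fin 2)).pow (d - i)).mul
      ((MvPolynomial.isHomogeneous_X k (1 : Fin 2)).pow (min i d))
    rw [MvPolynomial.mem_homogeneousSubmodule]
    convert this using 1
    omega⟩

theorem mono_coe {d i : ℕ} (h : i ≤ d) :
    (mono k d i : MvPolynomial (Fin 2) k) = X 0 ^ (d - i) * X 1 ^ i := by
  simp only [mono, min_eq_left h]

theorem mono_coe' {d i : ℕ} (h : i ≤ d) :
    (mono k d i : MvPolynomial (Fin 2) k) = MvPolynomial.monomial (expo (d - i) i) 1 := by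
  rw [mono_coe h, X_pow_mul_X_pow]

theorem coeff_mono {d i : ℕ} (h : i ≤ d) (m : Fin 2 →₀ ℕ) :
    MvPolynomial.coeff m (mono k d i : MvPolynomial (Fin 2) k) =
      if expo (d - i) i = m then 1 else 0 := by
  classical
  rw [mono_coe' h, MvPolynomial.coeff_monomial]

variable (k) in
/-- The basis of the binary forms of degree `d` consisting of monomials. -/
def monoBasis (d : ℕ) : Module.Basis (Fin (d + 1)) k (Forms k d) :=
  Module.Basis.ofEquivFun
    { toFun := fun f i => MvPolynomial.coeff (expo (d - i) i) (f : MvPolynomial (Fin 2) k)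
      map_add' := fun f g => by ext i; simp
      map_smul' := fun c f => by ext i; simp
      invFun := fun c => ∑ i, c i • mono k d i
      left_inv := fun f => by
        ext m
        have hf : (f : MvPolynomial (Fin 2) k).IsHomogeneous d := f.2
        simp only [AddSubmonoidClass.coe_finsetSum, Submodule.coe_smul, MvPolynomial.coeff_sum,
          MvPolynomial.coeff_smul, smul_eq_mul]
        by_cases hm : m.degree = d
        · rw [degree_fin_two] at hm
          rw [Finset.sum_eq_single ⟨m 1, by omega⟩]
          · have : expo (d - m 1) (m 1) = m := by
              rw [← hm, Nat.add_sub_cancel, expo_self]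
            simp [coeff_mono (show m 1 ≤ d by omega), this]
          · intro i _ hi
            rw [coeff_mono (by omega), if_neg, mul_zero]
            intro h
            apply hi
            ext
            simp [← h]
          · simp
        · rw [hf.coeff_eq_zero hm]
          refine Finset.sum_eq_zero fun i _ => ?_
          have : ((mono k d i : Forms k d) : MvPolynomial (Fin 2) k).IsHomogeneous d :=
            (mono k d i).2
          rw [this.coeff_eq_zero hm, mul_zero]
      right_inv := fun c => by
        ext i
        simp only [AddSubmonoidClass.coe_finsetSum, Submodule.coe_smul, MvPolynomial.coeff_sum,
          MvPolynomial.coeff_smul, smul_eq_mul]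
        rw [Finset.sum_eq_single i]
        · simp [coeff_mono (show (i : ℕ) ≤ d by omega)]
        · intro j _ hj
          rw [coeff_mono (by omega), if_neg, mul_zero]
          intro h
          apply hj
          ext
          simpa using DFunLike.congr_fun h 1
        · simp }

theorem monoBasis_apply (d : ℕ) (i : Fin (d + 1)) : monoBasis k d i = mono k d i := by
  rw [monoBasis, Module.Basis.coe_ofEquivFun]
  change ∑ j, Function.update (0 : Fin (d + 1) → k) i 1 j • mono k d j = _
  rw [Finset.sum_eq_single i]
  · simp
  · intro j _ hj
    simp [hj]
  · simp

instance (d : ℕ) : FiniteDimensional k (Forms k d) := (monoBasis k d).finiteDimensional_of_finite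

theorem finrank_forms (d : ℕ) : Module.finrank k (Forms k d) = d + 1 := by
  rw [Module.finrank_eq_card_basis (monoBasis k d), Fintype.card_fin]

instance (d : ℕ) : Nontrivial (Forms k d) :=
  Module.nontrivial_of_finrank_pos (R := k) (by rw [finrank_forms]; omega)

/-- The expansion of a form in monomials. -/
theorem forms_eq_sum (d : ℕ) (f : Forms k d) :
    ∃ c : ℕ → k, f = ∑ i ∈ Finset.range (d + 1), c i • mono k d i := by
  refine ⟨fun i => if h : i < d + 1 then (monoBasis k d).repr f ⟨i, h⟩ else 0, ?_⟩
  rw [Finset.sum_range]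
  conv_lhs => rw [← (monoBasis k d).sum_repr f]
  refine Finset.sum_congr rfl fun i _ => ?_
  simp [monoBasis_apply, i.2]

end Poly

/-! ### Irreducibility of the forms of degree less than p -/

section Irreducible

/-- A Vandermonde argument: modulo N, every functional turns the sum into a polynomial in t of
degree less than p that vanishes at the p elements of the prime field, hence is zero. -/
theorem mem_of_forall_sum_pow_mem {k M : Type*} [Field k] [AddCommGroup M] [Module k M] (p : ℕ)
    [Fact p.Prime] [CharP k p] (N : Submodule k M) (d : ℕ) (hd : d < p) (v : ℕ → M)
    (h : ∀ t : ZMod p,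
      ∑ j ∈ Finset.range (d + 1), (ZMod.castHom dvd_rfl k t) ^ j • v j ∈ N)
    (j : ℕ) (hj : j ≤ d) : v j ∈ N := by
  rw [← Submodule.Quotient.mk_eq_zero, ← Submodule.mkQ_apply,
    ← Module.forall_dual_apply_eq_zero_iff k]
  intro φ
  set P : Polynomial k := ∑ j ∈ Finset.range (d + 1),
    Polynomial.monomial j (φ (N.mkQ (v j))) with hP
  have hP0 : P = 0 := by
    refine Polynomial.eq_zero_of_natDegree_lt_card_of_eval_eq_zero P
      (f := fun t : ZMod p => ZMod.castHom dvd_rfl k t) (RingHom.injective _) (fun t => ?_) ?_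
    · have h1 := (Submodule.Quotient.mk_eq_zero N).2 (h t)
      rw [← Submodule.mkQ_apply] at h1
      have h2 := congrArg φ h1
      rw [map_zero, map_sum, map_sum] at h2
      rw [hP, Polynomial.eval_finsetSum, ← h2]
      refine Finset.sum_congr rfl fun i _ => ?_
      rw [Polynomial.eval_monomial, map_smul, map_smul, smul_eq_mul, mul_comm]
    · rw [ZMod.card]
      refine lt_of_le_of_lt (Polynomial.natDegree_sum_le_of_forall_le _ _ fun i hi => ?_) hd
      refine (Polynomial.natDegree_monomial_le _).trans ?_
      simp at hi; omega
  have := congrArg (fun P => Polynomial.coeff P j) hP0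
  simpa [hP, Polynomial.finsetSum_coeff, Polynomial.coeff_monomial,
    Finset.sum_ite_eq', show j < d + 1 by omega] using this

theorem isIrreducible_of_forall {k Γ A : Type*} [Field k] [Group Γ] [AddCommGroup A] [Module k A]
    [Nontrivial A] (ρ : Representation k Γ A)
    (h : ∀ N : Submodule k A, (∀ g, ∀ x ∈ N, ρ g x ∈ N) → (∃ x ∈ N, x ≠ 0) → N = ⊤) :
    Representation.IsIrreducible ρ where
  exists_pair_ne := by
    refine ⟨⊥, ⊤, fun hbt => ?_⟩
    have := congrArg Subrepresentation.toSubmodule hbt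
    exact bot_ne_top (α := Submodule k A) this
  eq_bot_or_eq_top N := by
    by_cases hN : ∃ x ∈ N.toSubmodule, x ≠ 0
    · exact .inr (Subrepresentation.toSubmodule_injective
        (h N.toSubmodule (fun g x hx => N.apply_mem_toSubmodule g hx) hN))
    · left
      push Not at hN
      exact Subrepresentation.toSubmodule_injective ((Submodule.eq_bot_iff _).2 hN)

variable {k : Type u} [Field k] {p : ℕ} [CharP k p]

variable (p) in
/-- The upper unitriangular matrices. -/
def upper (t : ZMod p) : G p := ⟨!![1, t; 0, 1], by simp [Matrix.det_fin_two_of]⟩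

variable (p) in
/-- The lower unitriangular matrices. -/
def lower (t : ZMod p) : G p := ⟨!![1, 0; t, 1], by simp [Matrix.det_fin_two_of]⟩

open MvPolynomial (C X)

theorem formRep_upper_mono (d i : ℕ) (hi : i ≤ d) (t : ZMod p) :
    formRep k p d (upper p t) (mono k d i) = ∑ j ∈ Finset.range (d + 1),
      (ZMod.castHom dvd_rfl k t) ^ j • ((i.choose j : k) • mono k d (i - j)) := by
  ext1
  rw [formRep_apply_coe, mono_coe hi, map_mul, map_pow, map_pow, subst_X, subst_X]
  simp only [AddSubmonoidClass.coe_finsetSum, Submodule.coe_smul]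
  simp only [entry, upper, Matrix.of_apply, Matrix.cons_val', Matrix.cons_val_zero,
    Matrix.cons_val_one, Matrix.cons_val_fin_one, map_one, map_zero, one_mul, zero_mul, add_zero]
  rw [add_pow, Finset.mul_sum]
  -- Summing up to d makes the range independent of i; the added terms have zero binomial
  -- coefficient.
  have hsub : Finset.range (i + 1) ⊆ Finset.range (d + 1) := by
    intro x; simp; omega
  rw [← Finset.sum_subset hsub]
  · refine Finset.sum_congr rfl fun j hj => ?_
    have hj : j ≤ i := by simp at hj; omega
    rw [mono_coe (by omega), mul_pow, show d - (i - j) = d - i + j by omega, pow_add]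
    simp only [MvPolynomial.smul_eq_C_mul, map_pow, map_natCast]
    ring
  · intro j _ hj
    have hj : i < j := by simp at hj; omega
    rw [Nat.choose_eq_zero_of_lt hj]
    simp

theorem formRep_lower_mono (d : ℕ) (t : ZMod p) :
    formRep k p d (lower p t) (mono k d 0) = ∑ j ∈ Finset.range (d + 1),
      (ZMod.castHom dvd_rfl k t) ^ j • ((d.choose j : k) • mono k d j) := by
  ext1
  rw [formRep_apply_coe, mono_coe (Nat.zero_le _), map_mul, map_pow, map_pow, subst_X, subst_X]
  simp only [AddSubmonoidClass.coe_finsetSum, Submodule.coe_smul]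
  simp only [entry, lower, Matrix.of_apply, Matrix.cons_val', Matrix.cons_val_zero,
    Matrix.cons_val_one, Matrix.cons_val_fin_one, map_one, map_zero, one_mul, zero_mul, zero_add,
    pow_zero, mul_one, Nat.sub_zero]
  rw [add_comm, add_pow]
  refine Finset.sum_congr rfl fun j hj => ?_
  have hj : j ≤ d := by simp at hj; omega
  rw [mono_coe hj, mul_pow]
  simp only [MvPolynomial.smul_eq_C_mul, map_pow, map_natCast]
  ring

theorem natCast_choose_ne_zero [Fact p.Prime] {d j : ℕ} (hd : d < p) (hj : j ≤ d) :
    (d.choose j : k) ≠ 0 := by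
  rw [Ne, CharP.cast_eq_zero_iff k p]
  intro h
  have h1 : p ∣ d.factorial := by
    rw [← Nat.choose_mul_factorial_mul_factorial hj, mul_assoc]
    exact h.mul_right _
  have := (Nat.Prime.dvd_factorial (Fact.out : p.Prime)).1 h1
  omega

/-- Highest weight argument: upper unitriangular matrices extract X ^ d from any nonzero invariant
subspace, and lower ones then produce every monomial, because the binomial coefficients of d < p are
nonzero in k. -/
theorem isIrreducible_formRep [Fact p.Prime] {d : ℕ} (hd : d < p) :
    Representation.IsIrreducible (formRep k p d) := by
  refine isIrreducible_of_forall _ fun N hN ⟨f, hf, hf0⟩ => ?_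
  classical
  obtain ⟨c, hc⟩ := forms_eq_sum d f
  have hex : ∃ i ∈ Finset.range (d + 1), c i ≠ 0 := by
    by_contra hcon
    push Not at hcon
    exact hf0 (hc.trans (Finset.sum_eq_zero fun i hi => by rw [hcon i hi, zero_smul]))
  obtain ⟨J, hJ, hmax⟩ := Finset.exists_max_image
    ((Finset.range (d + 1)).filter fun i => c i ≠ 0) id
    (by obtain ⟨i, h1, h2⟩ := hex; exact ⟨i, Finset.mem_filter.2 ⟨h1, h2⟩⟩)
  rw [Finset.mem_filter] at hJ
  have hJd : J ≤ d := by have := hJ.1; simp at this; omega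
  have h0 : mono k d 0 ∈ N := by
    -- With J the largest index in the support of f, the coefficient of t ^ J in the translate of f
    -- is c J times X ^ d: smaller i have vanishing binomial, larger i vanishing c i.
    have h1 := mem_of_forall_sum_pow_mem p N d hd
      (fun j => ∑ i ∈ Finset.range (d + 1), c i • ((i.choose j : k) • mono k d (i - j)))
      (fun t => by
        have h2 := hN (upper p t) f hf
        rw [hc, map_sum] at h2
        convert h2 using 1
        simp_rw [Finset.smul_sum]
        rw [Finset.sum_comm]
        refine Finset.sum_congr rfl fun i hi => ?_
        rw [map_smul, formRep_upper_mono d i (by simp at hi; omega), Finset.smul_sum]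
        refine Finset.sum_congr rfl fun j _ => ?_
        rw [smul_comm]) J hJd
    rw [Finset.sum_eq_single J] at h1
    · simp only [Nat.choose_self, Nat.cast_one, one_smul, Nat.sub_self] at h1
      exact (Submodule.smul_mem_iff _ hJ.2).1 h1
    · intro i hi hiJ
      rcases lt_or_gt_of_ne hiJ with h | h
      · rw [Nat.choose_eq_zero_of_lt h]; simp
      · by_cases hci : c i = 0
        · rw [hci, zero_smul]
        · have : i ≤ J := hmax i (Finset.mem_filter.2 ⟨hi, hci⟩)
          omega
    · intro h; exact absurd hJ.1 h
  have hall : ∀ j ≤ d, mono k d j ∈ N := by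
    intro j hj
    have h1 := mem_of_forall_sum_pow_mem p N d hd
      (fun j => (d.choose j : k) • mono k d j)
      (fun t => by rw [← formRep_lower_mono]; exact hN _ _ h0) j hj
    exact (Submodule.smul_mem_iff _ (natCast_choose_ne_zero hd hj)).1 h1
  rw [eq_top_iff, ← (monoBasis k d).span_eq, Submodule.span_le]
  rintro _ ⟨i, rfl⟩
  rw [monoBasis_apply]
  exact hall _ (by omega)

end Irreducible

theorem diag_mul_eq {p : ℕ} (g : G p) : g.1 0 0 * g.1 1 1 = 1 + g.1 0 1 * g.1 1 0 := by
  have h := g.2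
  rw [Matrix.det_fin_two] at h
  linear_combination h

/-! ### Power sums over the prime field and over the group -/

section PowerSums

variable (p : ℕ) [Fact p.Prime]

/-- The exponent 0 is excluded because 0 ^ 0 = 1 makes that sum equal to p = 0. -/
theorem ZMod.sum_pow (e : ℕ) :
    ∑ x : ZMod p, x ^ e = if e ≠ 0 ∧ (p - 1) ∣ e then -1 else 0 := by
  classical
  by_cases he : e = 0
  · simp [he]
  have h1 := FiniteField.sum_pow_units (ZMod p) e
  rw [ZMod.card] at h1
  simp only [ne_eq, he, not_false_eq_true, true_and]
  rw [← h1, ← Finset.sum_subset (Finset.subset_univ (Finset.univ.erase (0 : ZMod p)))]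
  · symm
    refine Finset.sum_bij (fun u _ => (u : ZMod p)) (by simp) (fun a _ b _ h => Units.ext h) ?_
      (by simp)
    intro b hb
    exact ⟨Units.mk0 b (Finset.ne_of_mem_erase hb), Finset.mem_univ _, rfl⟩
  · intro x _ hx
    have : x = 0 := by simpa using hx
    rw [this, zero_pow he]

theorem ZMod.sum_pow_pred : ∑ x : ZMod p, x ^ (p - 1) = -1 := by
  have := (Fact.out : p.Prime).two_le
  rw [ZMod.sum_pow, if_pos ⟨by omega, dvd_rfl⟩]

/-- Matrices (a b; c d) with d = 0 contribute nothing; the others are parametrised by d ≠ 0, b and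
c, with ad = 1 + bc. For b ≠ 0 the sum over c runs over all of the field and is -1; for b = 0 it is
p = 0. The total is (p-1)(p-1)(-1) = -1. -/
theorem sum_diag_pow :
    ∑ g : G p, (g.1 0 0) ^ (p - 1) * (g.1 1 1) ^ (p - 1) = (-1 : ZMod p) := by
  classical
  have hp := (Fact.out : p.Prime).two_le
  rw [← Finset.sum_filter_of_ne (p := fun g : G p => g.1 1 1 ≠ 0)]
  · have : ∑ g : G p with g.1 1 1 ≠ 0, (g.1 0 0) ^ (p - 1) * (g.1 1 1) ^ (p - 1) =
        ∑ x ∈ (Finset.univ.erase (0 : ZMod p)) ×ˢ (Finset.univ : Finset (ZMod p × ZMod p)),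
          (1 + x.2.1 * x.2.2) ^ (p - 1) := by
      refine Finset.sum_bij' (fun g _ => (g.1 1 1, g.1 0 1, g.1 1 0))
        (fun x hx => ⟨!![(1 + x.2.1 * x.2.2) * x.1⁻¹, x.2.1; x.2.2, x.1], ?_⟩) ?_ ?_ ?_ ?_ ?_
      · have : x.1 ≠ 0 := by simpa using hx
        rw [Matrix.det_fin_two_of]
        field_simp
        ring
      · intro g hg
        simpa using hg
      · intro x hx
        have hx : x.1 ≠ 0 := by simpa using hx
        exact Finset.mem_filter.2 ⟨Finset.mem_univ _, hx⟩
      · intro g hg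
        have hg : g.1 1 1 ≠ 0 := by simpa using hg
        have h := diag_mul_eq g
        ext i j
        fin_cases i <;> fin_cases j <;> simp
        rw [mul_inv_eq_iff_eq_mul₀ hg, h]
      · intro x hx
        simp
      · intro g hg
        rw [← mul_pow, diag_mul_eq]
    rw [this, Finset.sum_product]
    simp only [Finset.sum_const, Finset.card_erase_of_mem (Finset.mem_univ _), Finset.card_univ,
      ZMod.card]
    rw [Fintype.sum_prod_type, ← Finset.sum_sdiff (Finset.subset_univ {(0 : ZMod p)})]
    have h1 : ∀ b ∈ Finset.univ \ {(0 : ZMod p)}, ∑ c : ZMod p, (1 + b * c) ^ (p - 1) = -1 := by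
      intro b hb
      have hb : b ≠ 0 := by simpa using hb
      rw [← ZMod.sum_pow_pred p]
      refine Fintype.sum_bijective (fun c => 1 + b * c) ?_ _ _ fun c => rfl
      rw [← Finite.injective_iff_bijective]
      intro c c' h
      exact mul_left_cancel₀ hb (add_left_cancel h)
    rw [Finset.sum_congr rfl h1]
    simp [Finset.card_sdiff, Nat.cast_sub (show 1 ≤ p by omega)]
  · intro g _ h
    contrapose! h
    rw [h, zero_pow (by omega), mul_zero]

theorem upper_pow (n : ℕ) : upper p 1 ^ n = upper p n := by
  induction n with
  | zero =>
    rw [pow_zero]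
    ext i j
    fin_cases i <;> fin_cases j <;> simp [upper]
  | succ n ih =>
    rw [pow_succ, ih]
    ext i j
    rw [Matrix.SpecialLinearGroup.coe_mul]
    fin_cases i <;> fin_cases j <;> simp [upper, Matrix.mul_apply, Fin.sum_univ_two, add_comm]

theorem orderOf_upper : orderOf (upper p 1) = p := by
  refine orderOf_eq_prime ?_ ?_
  · rw [upper_pow]
    ext i j
    fin_cases i <;> fin_cases j <;> simp [upper]
  · intro h
    have := congrArg (fun g : G p => g.1 0 1) h
    simp [upper] at this

theorem card_eq_zero (k : Type u) [Field k] [CharP k p] : (Fintype.card (G p) : k) = 0 := by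
  rw [CharP.cast_eq_zero_iff k p]
  conv_lhs => rw [← orderOf_upper p]
  exact orderOf_dvd_card

end PowerSums

/-! ### Projectivity of the Steinberg module -/

section Steinberg

variable {k : Type u} [Field k] {p : ℕ} [CharP k p]

variable (k) in
/-- The coefficient of the highest power of `X`. -/
def leadCoeff (d : ℕ) : Forms k d →ₗ[k] k :=
  (MvPolynomial.aeval (fun i : Fin 2 => if i = 0 then (1 : k) else 0)).toLinearMap ∘ₗ
    (Forms k d).subtype

theorem leadCoeff_formRep_mono (d : ℕ) (g : G p) :
    leadCoeff k d (formRep k p d g (mono k d 0)) = entry k p g 0 0 ^ d := by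
  change MvPolynomial.aeval _ (formRep k p d g (mono k d 0) : MvPolynomial (Fin 2) k) = _
  rw [formRep_apply_coe, mono_coe (Nat.zero_le d), map_mul, map_pow, map_pow, subst_X, subst_X]
  simp

/-- The sum of the conjugates of the rank one map θ is equivariant, hence a scalar by Schur's lemma.
Its matrix coefficient at X ^ (p - 1) is the group sum computed above, so the scalar is -1 and -θ
works. -/
theorem isTraceProjective_formRep [Fact p.Prime] [IsAlgClosed k] :
    IsTraceProjective (formRep k p (p - 1)) := by
  have hp := (Fact.out : p.Prime).two_le
  have hirr := isIrreducible_formRep (k := k) (p := p) (d := p - 1) (by omega)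
  set ρ := formRep k p (p - 1) with hρ
  set θ : Module.End k (Forms k (p - 1)) := (leadCoeff k (p - 1)).smulRight (mono k (p - 1) 0)
    with hθ
  let T : IntertwiningMap ρ ρ :=
    { toLinearMap := ∑ g : G p, ρ g * (θ * ρ g⁻¹)
      isIntertwining' := fun h => by
        change (∑ g : G p, ρ g * (θ * ρ g⁻¹)) * ρ h = ρ h * ∑ g : G p, ρ g * (θ * ρ g⁻¹)
        rw [Finset.sum_mul, Finset.mul_sum]
        refine Fintype.sum_equiv (Equiv.mulLeft h⁻¹) _ _ fun g => ?_
        simp only [Equiv.coe_mulLeft, mul_inv_rev, inv_inv]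
        rw [← mul_assoc (ρ h), ← map_mul, mul_inv_cancel_left, map_mul, mul_assoc, mul_assoc] }
  have hT : ∀ x, T x = ∑ g : G p, ρ g (θ (ρ g⁻¹ x)) := by
    intro x
    change (∑ g : G p, ρ g * (θ * ρ g⁻¹)) x = _
    simp [LinearMap.sum_apply]
  obtain ⟨c, hc⟩ :=
    (Representation.IsIrreducible.algebraMap_intertwiningMap_bijective_of_isAlgClosed
      (ρ := ρ)).2 T
  have hc' : ∀ x, c • x = T x := fun x => DFunLike.congr_fun hc x
  have hc1 : c = -1 := by
    have h1 := congrArg (leadCoeff k (p - 1)) (hc' (mono k (p - 1) 0))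
    have h2 := leadCoeff_formRep_mono (k := k) (p := p) (p - 1) 1
    rw [map_one, Module.End.one_apply] at h2
    rw [map_smul, h2, hT, map_sum] at h1
    have h3 : ∀ g : G p, leadCoeff k (p - 1) (ρ g (θ (ρ g⁻¹ (mono k (p - 1) 0)))) =
        ZMod.castHom dvd_rfl k ((g.1 0 0) ^ (p - 1) * (g.1 1 1) ^ (p - 1)) := by
      intro g
      rw [hθ, LinearMap.smulRight_apply, map_smul, map_smul, leadCoeff_formRep_mono,
        leadCoeff_formRep_mono, map_mul, map_pow, map_pow, smul_eq_mul, mul_comm]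
      simp [entry, Matrix.SpecialLinearGroup.SL2_inv_expl]
    rw [Finset.sum_congr rfl fun g _ => h3 g, ← map_sum, sum_diag_pow, map_neg, map_one] at h1
    simpa [entry] using h1
  refine ⟨-θ, fun x => ?_⟩
  have h4 := hc' x
  rw [hT, hc1] at h4
  have h5 : ∀ g : G p, ρ g ((-θ) (ρ g⁻¹ x)) = -ρ g (θ (ρ g⁻¹ x)) := fun g => by
    rw [LinearMap.neg_apply, map_neg]
  rw [Finset.sum_congr rfl fun g _ => h5 g, Finset.sum_neg_distrib, ← h4]
  exact (congrArg Neg.neg (neg_one_smul k x)).trans (neg_neg x)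

end Steinberg

/-! ### Self-duality of the forms -/

section Duality

variable {k : Type u} [Field k] {p : ℕ} [CharP k p]

open MvPolynomial (C X pderiv)

variable (k) in
/-- The polarity pairing on polynomials of degree `d`. -/
def polarity : ℕ → MvPolynomial (Fin 2) k →ₗ[k] MvPolynomial (Fin 2) k →ₗ[k] k
  | 0 => (LinearMap.mul k k).compl₁₂ (MvPolynomial.aeval fun _ => (0 : k)).toLinearMap
      (MvPolynomial.aeval fun _ => (0 : k)).toLinearMap
  | d + 1 => (polarity d).compl₁₂ (pderiv 0).toLinearMap (pderiv 1).toLinearMap -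
      (polarity d).compl₁₂ (pderiv 1).toLinearMap (pderiv 0).toLinearMap

theorem polarity_zero (f h : MvPolynomial (Fin 2) k) :
    polarity k 0 f h = MvPolynomial.aeval (fun _ : Fin 2 => (0 : k)) f *
      MvPolynomial.aeval (fun _ : Fin 2 => (0 : k)) h := rfl

theorem polarity_succ (d : ℕ) (f h : MvPolynomial (Fin 2) k) :
    polarity k (d + 1) f h = polarity k d (pderiv 0 f) (pderiv 1 h) -
      polarity k d (pderiv 1 f) (pderiv 0 h) := rfl

/-- The pairing iterates Cayley's operator ∂_X ⊗ ∂_Y - ∂_Y ⊗ ∂_X, which a substitution multiplies by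
det g = 1. -/
theorem polarity_subst (d : ℕ) (g : G p) (f h : MvPolynomial (Fin 2) k) :
    polarity k d (subst k p g f) (subst k p g h) = polarity k d f h := by
  induction d generalizing f h with
  | zero =>
    have : ∀ f, MvPolynomial.aeval (fun _ : Fin 2 => (0 : k)) (subst k p g f) =
        MvPolynomial.aeval (fun _ : Fin 2 => (0 : k)) f := by
      intro f
      rw [← AlgHom.comp_apply]
      congr 1
      ext i
      simp [subst_X]
    rw [polarity_zero, polarity_zero, this, this]
  | succ d ih =>
    have hd := entry_det (k := k) g
    rw [polarity_succ, polarity_succ, pderiv_subst, pderiv_subst, pderiv_subst, pderiv_subst]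
    simp only [← MvPolynomial.smul_eq_C_mul, map_add, map_smul, LinearMap.add_apply,
      LinearMap.smul_apply, ih, smul_eq_mul]
    linear_combination (polarity k d (pderiv 0 f) (pderiv 1 h) -
      polarity k d (pderiv 1 f) (pderiv 0 h)) * hd

theorem polarity_X_pow (d : ℕ) :
    polarity k d (X 0 ^ d) (X 1 ^ d) = (d.factorial : k) ^ 2 := by
  induction d with
  | zero =>
    rw [polarity_zero]
    simp
  | succ d ih =>
    have h1 : ∀ i : Fin 2, pderiv i ((X i : MvPolynomial (Fin 2) k) ^ (d + 1)) =
        ((d + 1 : ℕ) : k) • X i ^ d := by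
      intro i
      rw [MvPolynomial.pderiv_pow, MvPolynomial.pderiv_X_self, MvPolynomial.smul_eq_C_mul]
      simp
    have h2 : pderiv 1 ((X 0 : MvPolynomial (Fin 2) k) ^ (d + 1)) = 0 := by
      rw [MvPolynomial.pderiv_pow, MvPolynomial.pderiv_X_of_ne (by decide), mul_zero]
    rw [polarity_succ, h1, h1, h2, map_zero, LinearMap.zero_apply, sub_zero, map_smul, map_smul,
      LinearMap.smul_apply, ih, Nat.factorial_succ]
    push_cast
    simp only [smul_eq_mul]
    ring

variable (k p) in
/-- The map from forms to dual forms given by the polarity pairing. -/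
def toDual (d : ℕ) : IntertwiningMap (formRep k p d) (formRep k p d).dual where
  toLinearMap := (polarity k d).compl₁₂ (Forms k d).subtype (Forms k d).subtype
  isIntertwining' g := by
    ext f h
    have := polarity_subst d g (f : MvPolynomial (Fin 2) k) (formRep k p d g⁻¹ h)
    rw [← formRep_apply_coe, ← formRep_apply_coe, self_inv_apply] at this
    exact this

/-- The pairing of X ^ d with Y ^ d is (d!) ^ 2, nonzero for d < p; irreducibility turns this into
nondegeneracy. -/
theorem nonempty_equiv_dual [Fact p.Prime] {d : ℕ} (hd : d < p) :
    Nonempty (Representation.Equiv (formRep k p d) (formRep k p d).dual) := by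
  have hirr := isIrreducible_formRep (k := k) hd
  have hinj : Function.Injective (toDual k p d) := by
    rcases Representation.IsIrreducible.injective_or_eq_zero (toDual k p d) with h | h
    · exact h
    · exfalso
      have h1 : toDual k p d (mono k d 0) (mono k d d) = 0 := by rw [h]; rfl
      have h2 : toDual k p d (mono k d 0) (mono k d d) =
        polarity k d (mono k d 0 : MvPolynomial (Fin 2) k) (mono k d d) := rfl
      rw [h2, mono_coe (Nat.zero_le d), mono_coe le_rfl] at h1
      simp only [pow_zero, mul_one, Nat.sub_zero, Nat.sub_self, one_mul, polarity_X_pow] at h1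
      have h3 := pow_eq_zero_iff (two_ne_zero) |>.1 h1
      rw [CharP.cast_eq_zero_iff k p, Nat.Prime.dvd_factorial Fact.out] at h3
      omega
  refine ⟨(toDual k p d).ofBijective ⟨hinj, ?_⟩⟩
  exact (LinearMap.injective_iff_surjective_of_finrank_eq_finrank
    (f := (toDual k p d).toLinearMap) Subspace.dual_finrank_eq.symm).1 hinj

end Duality

/-! ### Clebsch–Gordan maps for tensoring with V₂ -/

section Bilinear

variable {k : Type u} [Field k] {p : ℕ} [CharP k p]

open MvPolynomial (C X pderiv)

variable (k p) in
/-- Multiplication of forms. -/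
def mulMap (d e : ℕ) :
    IntertwiningMap ((formRep k p d).tprod (formRep k p e)) (formRep k p (d + e)) where
  toLinearMap := TensorProduct.lift (LinearMap.mk₂ k
    (fun f h => ⟨f.1 * h.1, MvPolynomial.IsHomogeneous.mul f.2 h.2⟩)
    (fun _ _ _ => Subtype.ext (add_mul _ _ _)) (fun _ _ _ => Subtype.ext (smul_mul_assoc _ _ _))
    (fun _ _ _ => Subtype.ext (mul_add _ _ _)) (fun _ _ _ => Subtype.ext (mul_smul_comm _ _ _)))
  isIntertwining' g := by
    ext f h : 4
    exact (map_mul (subst k p g) f.1 h.1).symm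

theorem mulMap_coe (d e : ℕ) (f : Forms k d) (h : Forms k e) :
    (mulMap k p d e (f ⊗ₜ h) : MvPolynomial (Fin 2) k) = f * h := rfl

/-- The Jacobian determinant of two polynomials. -/
def jac (f h : MvPolynomial (Fin 2) k) : MvPolynomial (Fin 2) k :=
  pderiv 0 f * pderiv 1 h - pderiv 1 f * pderiv 0 h

theorem jac_mem {d e : ℕ} (f : Forms k (d + 1)) (h : Forms k (e + 1)) :
    jac f.1 h.1 ∈ Forms k (d + e) := by
  have hf : f.1.IsHomogeneous (d + 1) := f.2
  have hh : h.1.IsHomogeneous (e + 1) := h.2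
  exact (hf.pderiv.mul hh.pderiv).sub (hf.pderiv.mul hh.pderiv)

theorem jac_subst (g : G p) (f h : MvPolynomial (Fin 2) k) :
    jac (subst k p g f) (subst k p g h) = subst k p g (jac f h) := by
  have hd := congrArg (C (σ := Fin 2)) (entry_det (k := k) g)
  simp only [map_sub, map_mul, map_one] at hd
  simp only [jac, pderiv_subst, map_sub, map_mul]
  linear_combination (subst k p g (pderiv 0 f) * subst k p g (pderiv 1 h) -
    subst k p g (pderiv 1 f) * subst k p g (pderiv 0 h)) * hd

variable (k p) in
/-- The Jacobian determinant as a map of representations. -/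
def jacMap (d e : ℕ) :
    IntertwiningMap ((formRep k p (d + 1)).tprod (formRep k p (e + 1))) (formRep k p (d + e)) where
  toLinearMap := TensorProduct.lift (LinearMap.mk₂ k
    (fun f h => ⟨jac f.1 h.1, jac_mem f h⟩)
    (fun _ _ _ => Subtype.ext (by simp [jac]; ring))
    (fun _ _ _ => Subtype.ext (by simp [jac, smul_sub]))
    (fun _ _ _ => Subtype.ext (by simp [jac]; ring))
    (fun _ _ _ => Subtype.ext (by simp [jac, smul_sub])))
  isIntertwining' g := by
    ext f h : 4
    exact jac_subst g f.1 h.1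

theorem jacMap_coe (d e : ℕ) (f : Forms k (d + 1)) (h : Forms k (e + 1)) :
    (jacMap k p d e (f ⊗ₜ h) : MvPolynomial (Fin 2) k) = jac f.1 h.1 := rfl

variable (k) in
/-- The linear form `X`. -/
abbrev formX : Forms k 1 := mono k 1 0

variable (k) in
/-- The linear form `Y`. -/
abbrev formY : Forms k 1 := mono k 1 1

theorem formX_coe : (formX k : MvPolynomial (Fin 2) k) = X 0 := by
  rw [formX, mono_coe (by omega)]; simp

theorem formY_coe : (formY k : MvPolynomial (Fin 2) k) = X 1 := by
  rw [formY, mono_coe (by omega)]; simp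

theorem formRep_formX (g : G p) : formRep k p 1 g (formX k) =
    entry k p g 0 0 • formX k + entry k p g 1 0 • formY k := by
  ext1
  rw [formRep_apply_coe, formX_coe, subst_X]
  simp [formX_coe, formY_coe, MvPolynomial.smul_eq_C_mul]

theorem formRep_formY (g : G p) : formRep k p 1 g (formY k) =
    entry k p g 0 1 • formX k + entry k p g 1 1 • formY k := by
  ext1
  rw [formRep_apply_coe, formY_coe, subst_X]
  simp [formX_coe, formY_coe, MvPolynomial.smul_eq_C_mul]

variable {A B : Type*} [AddCommGroup A] [Module k A] [AddCommGroup B] [Module k B]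
  {ρ : Representation k (G p) A} {σ : Representation k (G p) B}

theorem ext_tmul_forms_one {φ ψ : A ⊗[k] Forms k 1 →ₗ[k] B}
    (hX : ∀ a, φ (a ⊗ₜ formX k) = ψ (a ⊗ₜ formX k))
    (hY : ∀ a, φ (a ⊗ₜ formY k) = ψ (a ⊗ₜ formY k)) : φ = ψ := by
  refine TensorProduct.ext (LinearMap.ext fun a => (monoBasis k 1).ext fun i => ?_)
  rw [monoBasis_apply]
  fin_cases i
  · exact hX a
  · exact hY a

/-- The map `A → B ⊗ V₂` adjoint to `A ⊗ V₂ → B` under the invariant symplectic form. -/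
def adjointMap (b : IntertwiningMap (ρ.tprod (formRep k p 1)) σ) :
    IntertwiningMap ρ (σ.tprod (formRep k p 1)) where
  -- The tensor X ⊗ Y - Y ⊗ X is invariant because det g = 1; its first leg is fed to b.
  toLinearMap :=
    (TensorProduct.mk k B (Forms k 1)).flip (formY k) ∘ₗ b.toLinearMap ∘ₗ
      (TensorProduct.mk k A (Forms k 1)).flip (formX k) -
    (TensorProduct.mk k B (Forms k 1)).flip (formX k) ∘ₗ b.toLinearMap ∘ₗ
      (TensorProduct.mk k A (Forms k 1)).flip (formY k)
  isIntertwining' g := by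
    ext a
    change b (ρ g a ⊗ₜ formX k) ⊗ₜ formY k - b (ρ g a ⊗ₜ formY k) ⊗ₜ formX k =
      σ.tprod (formRep k p 1) g
        (b (a ⊗ₜ formX k) ⊗ₜ formY k - b (a ⊗ₜ formY k) ⊗ₜ formX k)
    rw [map_sub, Representation.tprod_apply, TensorProduct.map_tmul, TensorProduct.map_tmul,
      ← IntertwiningMap.isIntertwining, ← IntertwiningMap.isIntertwining,
      Representation.tprod_apply, TensorProduct.map_tmul, TensorProduct.map_tmul,
      formRep_formX, formRep_formY]
    simp only [TensorProduct.tmul_add, TensorProduct.tmul_smul, map_add, map_smul,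
      TensorProduct.add_tmul, ← TensorProduct.smul_tmul', smul_add]
    have hd := entry_det (k := k) g
    match_scalars <;> first | ring1 | linear_combination hd | linear_combination -hd

theorem adjointMap_apply (b : IntertwiningMap (ρ.tprod (formRep k p 1)) σ) (a : A) :
    adjointMap b a = b (a ⊗ₜ formX k) ⊗ₜ formY k - b (a ⊗ₜ formY k) ⊗ₜ formX k := rfl

theorem jac_X (f : MvPolynomial (Fin 2) k) : jac f (X 0) = -pderiv 1 f := by
  simp [jac]

theorem jac_Y (f : MvPolynomial (Fin 2) k) : jac f (X 1) = pderiv 0 f := by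
  simp [jac]

theorem euler (d : ℕ) (f : Forms k d) :
    X 0 * pderiv 0 f.1 + X 1 * pderiv 1 f.1 = (d : k) • f.1 := by
  have hf : f.1.IsHomogeneous d := f.2
  have := hf.sum_X_mul_pderiv
  rw [Fin.sum_univ_two] at this
  rw [this, Nat.cast_smul_eq_nsmul]

/-- The composite is minus the Euler operator X ∂_X + Y ∂_Y. -/
theorem mulMap_adjointMap_jacMap (d : ℕ) (f : Forms k (d + 1)) :
    mulMap k p d 1 (adjointMap (jacMap k p d 0) f) = -((d + 1 : ℕ) : k) • f := by
  ext1
  rw [adjointMap_apply, map_sub]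
  rw [Submodule.coe_sub, mulMap_coe, mulMap_coe, jacMap_coe, jacMap_coe, formX_coe, formY_coe,
    jac_X, jac_Y, Submodule.coe_smul, neg_smul, ← euler]
  ring

/-- The composite is ∂_X (X f) + ∂_Y (Y f), that is 2f plus the Euler operator. -/
theorem jacMap_adjointMap_mulMap (d : ℕ) (f : Forms k d) :
    jacMap k p d 0 (adjointMap (mulMap k p d 1) f) = ((d + 2 : ℕ) : k) • f := by
  ext1
  have he := euler d f
  rw [adjointMap_apply, map_sub]
  rw [Submodule.coe_sub, jacMap_coe, jacMap_coe, mulMap_coe, mulMap_coe, formX_coe, formY_coe,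
    jac_X, jac_Y, Submodule.coe_smul, Nat.cast_add, add_smul, ← he, Nat.cast_two,
    two_smul]
  simp
  ring

/-- This splits the tensor product into forms of degree d + 2 and d as soon as d + 2 is invertible
in k. Stating it without division keeps it valid in every characteristic. -/
theorem tensor_forms_one_decomposition (d : ℕ) :
    ((-1 : k) • adjointMap (jacMap k p (d + 1) 0)).comp (mulMap k p (d + 1) 1) +
      (adjointMap (mulMap k p d 1)).comp (jacMap k p d 0) =
      ((d + 2 : ℕ) : k) • .id ((formRep k p (d + 1)).tprod (formRep k p 1)) := by
  apply IntertwiningMap.ext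
  refine ext_tmul_forms_one (A := Forms k (d + 1)) (B := Forms k (d + 1) ⊗[k] Forms k 1)
    (fun f => ?_) (fun f => ?_)
  · change (-1 : k) • (adjointMap (jacMap k p (d + 1) 0)
        (mulMap k p (d + 1) 1 (f ⊗ₜ[k] formX k)) : Forms k (d + 1) ⊗[k] Forms k 1) +
      adjointMap (mulMap k p d 1) (jacMap k p d 0 (f ⊗ₜ[k] formX k)) =
      ((d + 2 : ℕ) : k) • (f ⊗ₜ[k] formX k)
    -- Of the two components of the adjoint maps, one cancels; the other leaves (d + 2) f by Euler's
    -- identity.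
    have e1 : jacMap k p (d + 1) 0 (mulMap k p (d + 1) 1 (f ⊗ₜ[k] formX k) ⊗ₜ formX k) =
        mulMap k p d 1 (jacMap k p d 0 (f ⊗ₜ[k] formX k) ⊗ₜ formX k) := by
      ext1
      rw [jacMap_coe, mulMap_coe, mulMap_coe, jacMap_coe, formX_coe, jac_X, jac_X]
      simp
      ring
    have e2 : jacMap k p (d + 1) 0 (mulMap k p (d + 1) 1 (f ⊗ₜ[k] formX k) ⊗ₜ formY k) =
        mulMap k p d 1 (jacMap k p d 0 (f ⊗ₜ[k] formX k) ⊗ₜ formY k) +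
          ((d + 2 : ℕ) : k) • f := by
      ext1
      have he := euler (d + 1) f
      rw [Submodule.coe_add, jacMap_coe, mulMap_coe, mulMap_coe, jacMap_coe, formX_coe,
        formY_coe, jac_X, jac_Y, Submodule.coe_smul, show d + 2 = d + 1 + 1 from rfl,
        Nat.cast_succ (d + 1), add_smul, ← he]
      simp
      ring
    rw [adjointMap_apply, adjointMap_apply, e1, e2, TensorProduct.add_tmul,
      ← TensorProduct.smul_tmul']
    module
  · change (-1 : k) • (adjointMap (jacMap k p (d + 1) 0)
        (mulMap k p (d + 1) 1 (f ⊗ₜ[k] formY k)) : Forms k (d + 1) ⊗[k] Forms k 1) +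
      adjointMap (mulMap k p d 1) (jacMap k p d 0 (f ⊗ₜ[k] formY k)) =
      ((d + 2 : ℕ) : k) • (f ⊗ₜ[k] formY k)
    have e1 : jacMap k p (d + 1) 0 (mulMap k p (d + 1) 1 (f ⊗ₜ[k] formY k) ⊗ₜ formY k) =
        mulMap k p d 1 (jacMap k p d 0 (f ⊗ₜ[k] formY k) ⊗ₜ formY k) := by
      ext1
      rw [jacMap_coe, mulMap_coe, mulMap_coe, jacMap_coe, formY_coe, jac_Y, jac_Y]
      simp
      ring
    have e2 : jacMap k p (d + 1) 0 (mulMap k p (d + 1) 1 (f ⊗ₜ[k] formY k) ⊗ₜ formX k) =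
        mulMap k p d 1 (jacMap k p d 0 (f ⊗ₜ[k] formY k) ⊗ₜ formX k) -
          ((d + 2 : ℕ) : k) • f := by
      ext1
      have he := euler (d + 1) f
      rw [Submodule.coe_sub, jacMap_coe, mulMap_coe, mulMap_coe, jacMap_coe, formX_coe,
        formY_coe, jac_X, jac_Y, Submodule.coe_smul, show d + 2 = d + 1 + 1 from rfl,
        Nat.cast_succ (d + 1), add_smul, ← he]
      simp
      ring
    rw [adjointMap_apply, adjointMap_apply, e1, e2, TensorProduct.sub_tmul,
      ← TensorProduct.smul_tmul']
    module

end Bilinear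

/-! ### Functions on the plane over the prime field -/

section Functions

variable (k : Type u) [Field k] (p : ℕ)

/-- The representation of `SL₂(𝔽_p)` on the functions on `𝔽_p²`. -/
def funRep : Representation k (G p) ((Fin 2 → ZMod p) → k) where
  toFun g := LinearMap.funLeft k k fun v => Matrix.vecMul v g.1
  map_one' := by
    ext F v
    simp [LinearMap.funLeft_apply]
  map_mul' g h := by
    ext F v
    simp [LinearMap.funLeft_apply, Matrix.vecMul_vecMul]

variable {k p}

theorem funRep_apply (g : G p) (F : (Fin 2 → ZMod p) → k) (v : Fin 2 → ZMod p) :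
    funRep k p g F v = F (Matrix.vecMul v g.1) := rfl

end Functions

/-! ### Embedding an irreducible representation into functions -/

section Embedding

variable {k : Type u} [Field k] {p : ℕ}
  {B : Type*} [AddCommGroup B] [Module k B] {σ : Representation k (G p) B}

theorem lower_pow (n : ℕ) : lower p 1 ^ n = lower p n := by
  induction n with
  | zero =>
    rw [pow_zero]
    ext i j
    fin_cases i <;> fin_cases j <;> simp [lower]
  | succ n ih =>
    rw [pow_succ, ih]
    ext i j
    rw [Matrix.SpecialLinearGroup.coe_mul]
    fin_cases i <;> fin_cases j <;> simp [lower, Matrix.mul_apply, Fin.sum_univ_two, add_comm]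

/-- In characteristic p the operator u - 1, for u of order dividing p, has p-th power u ^ p - 1 = 0.
It is therefore not surjective, and any functional killing its range is invariant. -/
theorem exists_dual_lower_invariant [Fact p.Prime] [CharP k p] [Nontrivial B] (σ : Representation k (G p) B) :
    ∃ φ : Module.Dual k B, φ ≠ 0 ∧ ∀ t x, φ (σ (lower p t) x) = φ x := by
  have : CharP (Module.End k B) p :=
    charP_of_injective_algebraMap (FaithfulSMul.algebraMap_injective k (Module.End k B)) p
  have hnil : (σ (lower p 1) - 1) ^ p = 0 := by
    rw [sub_pow_char_of_commute (p := p) (Commute.one_right _), one_pow, ← map_pow, lower_pow,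
      sub_eq_zero, ← map_one σ]
    congr 1
    ext i j
    fin_cases i <;> fin_cases j <;> simp [lower]
  have hlt : LinearMap.range (σ (lower p 1) - 1) < ⊤ := by
    rw [lt_top_iff_ne_top]
    intro h
    have hs : Function.Surjective ((σ (lower p 1) - 1) ^ p : Module.End k B) := by
      rw [Module.End.coe_pow]
      exact (LinearMap.range_eq_top.1 h).iterate p
    obtain ⟨x, hx⟩ := exists_ne (0 : B)
    obtain ⟨y, hy⟩ := hs x
    rw [hnil] at hy
    exact hx hy.symm
  obtain ⟨φ, hφ, hle⟩ := Submodule.exists_le_ker_of_lt_top _ hlt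
  refine ⟨φ, hφ, fun t => ?_⟩
  have h1 : ∀ x, φ (σ (lower p 1) x) = φ x := fun x => by
    have := hle ⟨x, rfl⟩
    rwa [LinearMap.mem_ker, LinearMap.sub_apply, Module.End.one_apply, map_sub,
      sub_eq_zero] at this
  have h2 : ∀ (n : ℕ) x, φ (σ (lower p 1 ^ n) x) = φ x := by
    intro n
    induction n with
    | zero => simp
    | succ n ih =>
      intro x
      rw [pow_succ', map_mul, Module.End.mul_apply, h1, ih]
  intro x
  have h3 := h2 t.val x
  rwa [lower_pow, ZMod.natCast_zmod_val] at h3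

/-- The first row determines the coset of the lower unitriangular group, which is why invariant
functionals yield functions of a row vector. -/
theorem exists_lower_mul_eq (g h : G p) (hgh : g.1 0 = h.1 0) :
    ∃ t, h = lower p t * g := by
  -- This is the lower left entry of h g⁻¹.
  refine ⟨h.1 1 0 * g.1 1 1 - h.1 1 1 * g.1 1 0, ?_⟩
  have e0 := congrFun hgh 0
  have e1 := congrFun hgh 1
  have d1 := diag_mul_eq g
  have d2 := diag_mul_eq h
  rw [← e0, ← e1] at d2
  ext i j
  rw [Matrix.SpecialLinearGroup.coe_mul]
  fin_cases i <;> fin_cases j <;>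
    simp [lower, Matrix.mul_apply, Fin.sum_univ_two, e0, e1]
  · rw [← e0]
    linear_combination (-h.1 1 0) * d1 + g.1 1 0 * d2
  · rw [← e1]
    linear_combination (-h.1 1 1) * d1 + g.1 1 1 * d2

open Classical in
/-- The function on `𝔽_p²` attached to a vector and an invariant linear form. -/
def matrixCoeff (σ : Representation k (G p) B) (φ : Module.Dual k B) (v : Fin 2 → ZMod p) :
    Module.Dual k B :=
  if h : ∃ g : G p, g.1 0 = v then φ ∘ₗ σ h.choose else 0

theorem matrixCoeff_row (φ : Module.Dual k B) (hφ : ∀ t x, φ (σ (lower p t) x) = φ x)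
    (g : G p) (x : B) : matrixCoeff σ φ (g.1 0) x = φ (σ g x) := by
  have h : ∃ h : G p, h.1 0 = g.1 0 := ⟨g, rfl⟩
  rw [matrixCoeff, dif_pos h, LinearMap.comp_apply]
  obtain ⟨t, ht⟩ := exists_lower_mul_eq _ _ h.choose_spec.symm
  rw [ht, map_mul, Module.End.mul_apply, hφ]

theorem row_mul (g h : G p) : (g * h).1 0 = Matrix.vecMul (g.1 0) h.1 := rfl

/-- Every irreducible representation embeds into the functions on `𝔽_p²`. -/
theorem exists_injective_funRep [Fact p.Prime] [CharP k p]
    [Representation.IsIrreducible σ] :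
    ∃ f : IntertwiningMap σ (funRep k p), Function.Injective f := by
  have hnt : Nontrivial B := (isIndecomposable_of_isIrreducible σ).1
  obtain ⟨φ, hφ0, hφ⟩ := exists_dual_lower_invariant σ
  let f : IntertwiningMap σ (funRep k p) :=
    { toLinearMap := LinearMap.pi fun v => matrixCoeff σ φ v
      isIntertwining' := fun h => by
        ext x v
        change matrixCoeff σ φ v (σ h x) = matrixCoeff σ φ (Matrix.vecMul v h.1) x
        by_cases hv : ∃ g : G p, g.1 0 = v
        · obtain ⟨g, rfl⟩ := hv
          rw [← row_mul, matrixCoeff_row φ hφ, matrixCoeff_row φ hφ, map_mul,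
            Module.End.mul_apply]
        -- Being a first row is preserved by right multiplication, so both sides take the default
        -- value 0.
        · have hv' : ¬ ∃ g : G p, g.1 0 = Matrix.vecMul v h.1 := by
            rintro ⟨g, hg⟩
            refine hv ⟨g * h⁻¹, ?_⟩
            rw [row_mul, hg, Matrix.vecMul_vecMul, ← Matrix.SpecialLinearGroup.coe_mul,
              mul_inv_cancel]
            simp
          rw [matrixCoeff, dif_neg hv, matrixCoeff, dif_neg hv']
          rfl }
  refine ⟨f, (Representation.IsIrreducible.injective_or_eq_zero f).resolve_right fun h => hφ0 ?_⟩
  ext x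
  have h1 : f x ((1 : G p).1 0) = 0 := by rw [h]; rfl
  have h2 : f x ((1 : G p).1 0) = φ (σ 1 x) := matrixCoeff_row φ hφ 1 x
  rw [h2] at h1
  simpa using h1

end Embedding

/-! ### Polynomial functions and the summation pairing -/

section Evaluation

variable {k : Type u} [Field k] {p : ℕ} [CharP k p]

open MvPolynomial (C X)

variable (k p) in
/-- The polynomial functions. -/
def evalFun : MvPolynomial (Fin 2) k →ₗ[k] ((Fin 2 → ZMod p) → k) :=
  LinearMap.pi fun v => (MvPolynomial.aeval fun i => ZMod.castHom dvd_rfl k (v i)).toLinearMap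

theorem evalFun_apply (f : MvPolynomial (Fin 2) k) (v : Fin 2 → ZMod p) :
    evalFun k p f v = MvPolynomial.aeval (fun i => ZMod.castHom dvd_rfl k (v i)) f := rfl

theorem evalFun_subst (g : G p) (f : MvPolynomial (Fin 2) k) :
    evalFun k p (subst k p g f) = funRep k p g (evalFun k p f) := by
  ext v
  rw [funRep_apply, evalFun_apply, evalFun_apply, ← AlgHom.comp_apply]
  congr 1
  ext j
  rw [AlgHom.comp_apply, subst_X]
  simp [entry, Matrix.vecMul, dotProduct, Fin.sum_univ_two, mul_comm]

theorem evalFun_mono {d i : ℕ} (h : i ≤ d) (v : Fin 2 → ZMod p) :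
    evalFun k p (mono k d i) v =
      (ZMod.castHom dvd_rfl k (v 0)) ^ (d - i) * (ZMod.castHom dvd_rfl k (v 1)) ^ i := by
  rw [evalFun_apply, mono_coe h]
  simp

variable [Fact p.Prime]

theorem vecMul_bijective (g : G p) :
    Function.Bijective fun v : Fin 2 → ZMod p => Matrix.vecMul v g.1 := by
  rw [← Finite.injective_iff_bijective]
  refine Function.LeftInverse.injective (g := fun v => Matrix.vecMul v (g⁻¹).1) fun v => ?_
  simp only [Matrix.vecMul_vecMul]
  rw [← Matrix.SpecialLinearGroup.coe_mul, mul_inv_cancel]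
  simp

variable (k p) in
/-- The pairing of functions with forms by summation of values. -/
def sumPairing (d : ℕ) : IntertwiningMap (funRep k p) (formRep k p d).dual where
  toLinearMap := LinearMap.mk₂ k (fun F h => ∑ v, F v * evalFun k p h v)
    (fun _ _ _ => by simp [add_mul, Finset.sum_add_distrib])
    (fun _ _ _ => by simp [mul_assoc, Finset.mul_sum])
    (fun _ _ _ => by simp [mul_add, Finset.sum_add_distrib])
    (fun _ _ _ => by simp [mul_left_comm, Finset.mul_sum])
  isIntertwining' g := by
    refine LinearMap.ext fun F => LinearMap.ext fun h => ?_
    change ∑ v, F (Matrix.vecMul v g.1) * evalFun k p h v =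
      ∑ v, F v * evalFun k p (subst k p g⁻¹ h) v
    refine Fintype.sum_bijective _ (vecMul_bijective g) _ _ fun v => ?_
    rw [evalFun_subst, funRep_apply, Matrix.vecMul_vecMul, ← Matrix.SpecialLinearGroup.coe_mul,
      mul_inv_cancel]
    simp

theorem sumPairing_apply (d : ℕ) (F : (Fin 2 → ZMod p) → k) (h : Forms k d) :
    sumPairing k p d F h = ∑ v, F v * evalFun k p h v := rfl

theorem exists_coeff_one_variable (h : ZMod p → k) :
    ∃ c : ℕ → k, ∀ x, h x = ∑ i ∈ Finset.range p, c i * (ZMod.castHom dvd_rfl k x) ^ i := by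
  classical
  have hinj : Set.InjOn (fun x : ZMod p => ZMod.castHom dvd_rfl k x)
    (Finset.univ : Finset (ZMod p)) := (RingHom.injective _).injOn
  set P := Lagrange.interpolate Finset.univ (fun x : ZMod p => ZMod.castHom dvd_rfl k x) h with hP
  refine ⟨P.coeff, fun x => ?_⟩
  have h1 := Lagrange.eval_interpolate_at_node h hinj (Finset.mem_univ x)
  have h2 : P.natDegree < p := by
    by_cases hP0 : P = 0
    · rw [hP0]; simpa using (Fact.out : p.Prime).pos
    · have := Lagrange.degree_interpolate_lt h hinj
      rw [Finset.card_univ, ZMod.card] at this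
      exact (Polynomial.natDegree_lt_iff_degree_lt hP0).2 this
  rw [← h1, ← hP, Polynomial.eval_eq_sum_range' h2]

theorem exists_coeff (F : (Fin 2 → ZMod p) → k) :
    ∃ c : ℕ → ℕ → k, ∀ v, F v = ∑ i ∈ Finset.range p, ∑ j ∈ Finset.range p,
      c i j * ((ZMod.castHom dvd_rfl k (v 0)) ^ i * (ZMod.castHom dvd_rfl k (v 1)) ^ j) := by
  choose c hc using fun y => exists_coeff_one_variable (k := k) (p := p) fun x => F ![x, y]
  choose c' hc' using fun i => exists_coeff_one_variable (k := k) (p := p) fun y => c y i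
  refine ⟨c', fun v => ?_⟩
  have hv : v = ![v 0, v 1] := by ext i; fin_cases i <;> rfl
  have h1 := hc (v 1) (v 0)
  rw [← hv] at h1
  rw [h1]
  refine Finset.sum_congr rfl fun i _ => ?_
  rw [hc', Finset.sum_mul]
  exact Finset.sum_congr rfl fun j _ => by ring

/-- The power sums of `𝔽_p` in `k`. -/
theorem sum_cast_pow (e : ℕ) : ∑ x : ZMod p, (ZMod.castHom dvd_rfl k x) ^ e =
    if e ≠ 0 ∧ (p - 1) ∣ e then (-1 : k) else 0 := by
  have := congrArg (ZMod.castHom dvd_rfl k) (ZMod.sum_pow p e)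
  rw [map_sum] at this
  simp only [map_pow] at this
  rw [this]
  split_ifs <;> simp

theorem sumPairing_mono (F : (Fin 2 → ZMod p) → k) (c : ℕ → ℕ → k)
    (hc : ∀ v, F v = ∑ i ∈ Finset.range p, ∑ j ∈ Finset.range p,
      c i j * ((ZMod.castHom dvd_rfl k (v 0)) ^ i * (ZMod.castHom dvd_rfl k (v 1)) ^ j))
    (a b : ℕ) :
    sumPairing k p (a + b) F (mono k (a + b) b) = ∑ i ∈ Finset.range p, ∑ j ∈ Finset.range p,
      c i j * ((∑ x : ZMod p, (ZMod.castHom dvd_rfl k x) ^ (i + a)) *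
        (∑ x : ZMod p, (ZMod.castHom dvd_rfl k x) ^ (j + b))) := by
  rw [sumPairing_apply]
  simp only [evalFun_mono (Nat.le_add_left b a), Nat.add_sub_cancel, hc, Finset.sum_mul]
  rw [Finset.sum_comm]
  refine Finset.sum_congr rfl fun i _ => ?_
  rw [Finset.sum_comm]
  refine Finset.sum_congr rfl fun j _ => ?_
  rw [Fintype.sum_equiv (finTwoArrowEquiv (ZMod p)) _
    (fun x : ZMod p × ZMod p => c i j * ((ZMod.castHom dvd_rfl k x.1) ^ (i + a) *
      (ZMod.castHom dvd_rfl k x.2) ^ (j + b)))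
    (fun v => by simp [pow_add]; ring)]
  rw [← Finset.mul_sum, Fintype.sum_prod_type]
  simp only [Finset.mul_sum]

/-- Pair F with X ^ (p-1-i) Y ^ (p-1-j), whose degree is less than p exactly because p - 1 ≤ i + j.
Power sums vanish unless the exponent is a positive multiple of p - 1, so essentially only c i j
survives. -/
theorem coeff_eq_zero_of_sumPairing_eq_zero (F : (Fin 2 → ZMod p) → k) (c : ℕ → ℕ → k)
    (hc : ∀ v, F v = ∑ i ∈ Finset.range p, ∑ j ∈ Finset.range p,
      c i j * ((ZMod.castHom dvd_rfl k (v 0)) ^ i * (ZMod.castHom dvd_rfl k (v 1)) ^ j))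
    (hF : ∀ d < p, sumPairing k p d F = 0) {i j : ℕ} (hi : i < p) (hj : j < p)
    (hij : p - 1 ≤ i + j) : c i j = 0 := by
  have hp := (Fact.out : p.Prime).two_le
  -- The exponent can be p - 1 or 2(p - 1); the second value occurs only for i = 0 and i' = p - 1.
  have hzero : ∀ i < p, ∀ i' < p, i' + (p - 1 - i) ≠ 0 ∧ (p - 1) ∣ i' + (p - 1 - i) →
      i' = i ∨ (i = 0 ∧ i' = p - 1) := by
    rintro i hi i' hi' ⟨h0, m, hm⟩
    have hm2 : m < 3 := by
      by_contra hcon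
      have : (p - 1) * 3 ≤ (p - 1) * m := Nat.mul_le_mul_left _ (by omega)
      omega
    interval_cases m <;> omega
  -- The only coefficient that can interfere is the corner c (p-1) (p-1). It is isolated by the
  -- constant form, with no interference, and then disposes of the exceptional cases.
  have key : ∀ i < p, ∀ j < p, p - 1 ≤ i + j →
      (c (p - 1) (p - 1) = 0 ∨ (i = p - 1 ∧ j = p - 1)) → c i j = 0 := by
    intro i hi j hj hij hcor
    have h1 := sumPairing_mono F c hc (p - 1 - i) (p - 1 - j)
    rw [hF _ (by omega), LinearMap.zero_apply] at h1
    rw [Finset.sum_eq_single i, Finset.sum_eq_single j] at h1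
    · rw [sum_cast_pow, sum_cast_pow, if_pos ⟨by omega, by
        rw [show i + (p - 1 - i) = p - 1 by omega]⟩, if_pos ⟨by omega, by
        rw [show j + (p - 1 - j) = p - 1 by omega]⟩] at h1
      simpa using h1.symm
    · intro j' hj' hne
      rw [Finset.mem_range] at hj'
      by_cases h2 : j' + (p - 1 - j) ≠ 0 ∧ (p - 1) ∣ j' + (p - 1 - j)
      · rcases hzero j hj j' hj' h2 with h3 | h3
        · exact absurd h3 hne
        · have : i = p - 1 := by omega
          rw [this, h3.2, hcor.resolve_right (by omega), zero_mul]
      · rw [sum_cast_pow (j' + _), if_neg h2, mul_zero, mul_zero]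
    · intro h; exact absurd (Finset.mem_range.2 hj) h
    · intro i' hi' hne
      rw [Finset.mem_range] at hi'
      refine Finset.sum_eq_zero fun j' hj' => ?_
      rw [Finset.mem_range] at hj'
      by_cases h2 : i' + (p - 1 - i) ≠ 0 ∧ (p - 1) ∣ i' + (p - 1 - i)
      · rcases hzero i hi i' hi' h2 with h3 | h3
        · exact absurd h3 hne
        · by_cases h4 : j' + (p - 1 - j) ≠ 0 ∧ (p - 1) ∣ j' + (p - 1 - j)
          · have : j' = p - 1 := by
              rcases hzero j hj j' hj' h4 with h5 | h5 <;> omega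
            rw [this, h3.2, hcor.resolve_right (by omega), zero_mul]
          · rw [sum_cast_pow (j' + _), if_neg h4, mul_zero, mul_zero]
      · rw [sum_cast_pow (i' + _), if_neg h2, zero_mul, mul_zero]
    · intro h; exact absurd (Finset.mem_range.2 hi) h
  exact key i hi j hj hij (.inl (key _ (by omega) _ (by omega) (by omega) (.inr ⟨rfl, rfl⟩)))

end Evaluation

/-! ### Classification of the simple modules -/

section Classification

variable {k : Type u} [Field k] {p : ℕ} [CharP k p]

open MvPolynomial (C X)

variable (k p) in
/-- The functions given by families of forms of degree less than `p - 1`. -/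
def evalForms : ((e : Fin (p - 1)) → Forms k e) →ₗ[k] ((Fin 2 → ZMod p) → k) :=
  ∑ e : Fin (p - 1), evalFun k p ∘ₗ (Forms k e).subtype ∘ₗ LinearMap.proj e

theorem evalForms_apply (f : (e : Fin (p - 1)) → Forms k e) :
    evalForms k p f = evalFun k p (∑ e, (f e : MvPolynomial (Fin 2) k)) := by
  rw [evalForms, LinearMap.sum_apply, map_sum]
  rfl

theorem evalForms_smul (g : G p) (f : (e : Fin (p - 1)) → Forms k e) :
    evalForms k p (fun e => formRep k p e g (f e)) = funRep k p g (evalForms k p f) := by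
  rw [evalForms_apply, evalForms_apply, ← evalFun_subst, map_sum (subst k p g)]
  rfl

variable [Fact p.Prime]

/-- A polynomial of total degree at most p - 2 that vanishes on the whole plane is zero; its
homogeneous components then vanish separately. -/
theorem evalForms_injective : Function.Injective (evalForms k p) := by
  rw [← LinearMap.ker_eq_bot, LinearMap.ker_eq_bot']
  intro f hf
  set P : MvPolynomial (Fin 2) k := ∑ e, (f e : MvPolynomial (Fin 2) k) with hP
  have hP0 : P = 0 := by
    refine MvPolynomial.eq_zero_of_eval_zero_at_prod_finset P
      (fun _ => Finset.univ.map ⟨fun x : ZMod p => ZMod.castHom dvd_rfl k x,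
        RingHom.injective _⟩) (fun i => ?_) (fun x hx => ?_)
    · rw [Finset.card_map, Finset.card_univ, ZMod.card]
      have h2 : P.totalDegree ≤ p - 2 := by
        refine MvPolynomial.totalDegree_finsetSum_le fun e _ => ?_
        have : (f e : MvPolynomial (Fin 2) k).IsHomogeneous e := (f e).2
        exact this.totalDegree_le.trans (by omega)
      have := (Fact.out : p.Prime).two_le
      exact lt_of_le_of_lt ((MvPolynomial.degreeOf_le_totalDegree P i).trans h2) (by omega)
    · simp only [Finset.mem_map, Finset.mem_univ, true_and, Function.Embedding.coeFn_mk] at hx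
      choose v hv using hx
      rw [evalForms_apply] at hf
      have h3 := congrFun hf v
      rw [evalFun_apply, MvPolynomial.aeval_eq_eval] at h3
      rw [← funext hv]
      exact h3
  funext e
  ext m
  have hc := congrArg (MvPolynomial.coeff m) hP0
  have hh : ∀ e, (f e : MvPolynomial (Fin 2) k).IsHomogeneous e := fun e => (f e).2
  by_cases hm : m.degree = e
  · rw [hP, MvPolynomial.coeff_sum, Finset.sum_eq_single e] at hc
    · exact hc
    · intro e' _ hne
      exact (hh e').coeff_eq_zero (fun h => hne (Fin.ext (h.symm.trans hm)))
    · simp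
  · simpa using (hh e).coeff_eq_zero hm

/-- Orthogonality to forms of degree less than p kills every coefficient with i + j ≥ p - 1; the
remaining monomials are grouped by degree. -/
theorem mem_range_evalForms (F : (Fin 2 → ZMod p) → k)
    (hF : ∀ d < p, sumPairing k p d F = 0) : F ∈ LinearMap.range (evalForms k p) := by
  obtain ⟨c, hc⟩ := exists_coeff F
  refine ⟨fun e => ∑ l ∈ Finset.range (e + 1), c (e - l) l • mono k e l, ?_⟩
  funext v
  rw [evalForms_apply, map_sum, Finset.sum_apply, hc v]
  have h1 : ∀ e : Fin (p - 1), evalFun k p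
      ((∑ l ∈ Finset.range (e + 1), c (e - l) l • mono k e l : Forms k e) :
        MvPolynomial (Fin 2) k) v = ∑ l ∈ Finset.range (e + 1), c (e - l) l *
        ((ZMod.castHom dvd_rfl k (v 0)) ^ (e - l : ℕ) * (ZMod.castHom dvd_rfl k (v 1)) ^ l) := by
    intro e
    rw [AddSubmonoidClass.coe_finsetSum, map_sum, Finset.sum_apply]
    refine Finset.sum_congr rfl fun l hl => ?_
    rw [Submodule.coe_smul, map_smul, Pi.smul_apply,
      evalFun_mono (by rw [Finset.mem_range] at hl; omega), smul_eq_mul]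
  rw [Finset.sum_congr rfl fun e _ => h1 e,
    Fin.sum_univ_eq_sum_range (fun e => ∑ l ∈ Finset.range (e + 1), c (e - l) l *
        ((ZMod.castHom dvd_rfl k (v 0)) ^ (e - l : ℕ) * (ZMod.castHom dvd_rfl k (v 1)) ^ l)) (p - 1),
    Finset.sum_sigma', ← Finset.sum_product',
    ← Finset.sum_filter_of_ne (s := Finset.range p ×ˢ Finset.range p)
      (p := fun x : ℕ × ℕ => x.1 + x.2 < p - 1)]
  · refine Finset.sum_nbij' (fun x => (x.1 - x.2, x.2)) (fun x => ⟨x.1 + x.2, x.2⟩) ?_ ?_ ?_ ?_ ?_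
    · rintro ⟨e, l⟩ h
      simp only [Finset.mem_sigma, Finset.mem_range] at h
      simp only [Finset.mem_filter, Finset.mem_product, Finset.mem_range]
      omega
    · rintro ⟨i, j⟩ h
      simp only [Finset.mem_filter, Finset.mem_product, Finset.mem_range] at h
      simp only [Finset.mem_sigma, Finset.mem_range]
      omega
    · rintro ⟨e, l⟩ h
      simp only [Finset.mem_sigma, Finset.mem_range] at h
      simp only [Nat.sub_add_cancel (show l ≤ e by omega)]
    · rintro ⟨i, j⟩ h
      simp
    · rintro ⟨e, l⟩ h
      rfl
  · rintro ⟨i, j⟩ h hne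
    simp only [Finset.mem_product, Finset.mem_range] at h
    by_contra hcon
    exact hne (by
      rw [coeff_eq_zero_of_sumPairing_eq_zero F c hc hF h.1 h.2 (by simpa using hcon), zero_mul])

/-- Every irreducible representation of `SL₂(𝔽_p)` is isomorphic to the forms of some degree less
than `p`. -/
theorem exists_equiv_formRep {B : Type*} [AddCommGroup B] [Module k B]
    (σ : Representation k (G p) B) [Representation.IsIrreducible σ] :
    ∃ d < p, Nonempty (Representation.Equiv σ (formRep k p d)) := by
  obtain ⟨f, hf⟩ := exists_injective_funRep (σ := σ)
  -- Either every pairing with forms vanishes on the image, which then lies in a direct sum of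
  -- spaces of forms, or some pairing maps σ onto a dual space of forms.
  by_cases hpair : ∀ d < p, (sumPairing k p d).comp f = 0
  · have hmem : ∀ x, f x ∈ LinearMap.range (evalForms k p) := fun x =>
      mem_range_evalForms _ fun d hd => DFunLike.congr_fun (hpair d hd) x
    choose L hL using hmem
    have hnt : Nontrivial B := (isIndecomposable_of_isIrreducible σ).1
    obtain ⟨x, hx⟩ := exists_ne (0 : B)
    have hLx : L x ≠ 0 := by
      intro h
      have := hL x
      rw [h, map_zero] at this
      exact hx (hf (this.symm.trans (map_zero f).symm))
    obtain ⟨e, he⟩ := Function.ne_iff.1 hLx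
    -- Uniqueness of preimages makes each homogeneous component equivariant; component e is nonzero
    -- at x.
    let φ : IntertwiningMap σ (formRep k p e) :=
      { toFun := fun x => L x e
        map_add' := fun x y => congrFun (f := L (x + y)) (g := L x + L y)
          (evalForms_injective (by rw [map_add, hL, hL, hL, map_add])) e
        map_smul' := fun c x => congrFun (f := L (c • x)) (g := c • L x)
          (evalForms_injective (by rw [map_smul, hL, hL, map_smul])) e
        isIntertwining' := fun g => by
          ext1 x
          exact congrFun (f := L (σ g x)) (g := fun e => formRep k p e g (L x e))
            (evalForms_injective (by
              rw [evalForms_smul, hL, hL, IntertwiningMap.isIntertwining])) e }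
    have hφ : φ ≠ 0 := fun h => he (DFunLike.congr_fun h x)
    have := isIrreducible_formRep (k := k) (p := p) (d := e) (by omega)
    exact ⟨e, by omega, ⟨φ.ofBijective
      ((Representation.IsIrreducible.bijective_or_eq_zero φ).resolve_right hφ)⟩⟩
  · push Not at hpair
    obtain ⟨d, hd, hne⟩ := hpair
    have := isIrreducible_formRep (k := k) (p := p) hd
    obtain ⟨e⟩ := nonempty_equiv_dual (k := k) hd
    have := isIrreducible_of_equiv e.symm
    exact ⟨d, hd, ⟨(((sumPairing k p d).comp f).ofBijective
      ((Representation.IsIrreducible.bijective_or_eq_zero _).resolve_right hne)).trans e.symm⟩⟩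

end Classification

theorem IsSummand.exists_indecomposable_tprod {k Γ : Type*} [Field k] [Group Γ]
    {A D : Type*} [AddCommGroup A] [Module k A] [FiniteDimensional k A]
    {ρ : Representation k Γ A} (hρ : IsIndecomposable k[Γ] ρ.asModule)
    {B : Type v} {B' : Type v} [AddCommGroup B] [Module k B] [FiniteDimensional k B]
    [AddCommGroup B'] [Module k B'] [FiniteDimensional k B'] [AddCommMonoid D] [Module k D]
    (σ : Representation k Γ B) (σ' : Representation k Γ B') {ν : Representation k Γ D}
    (h : IsSummand ρ ((σ.tprod σ').tprod ν)) :
    ∃ L : Rep.{v} k Γ, FiniteDimensional k L.V ∧ IsIndecomposable k[Γ] L.ρ.asModule ∧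
      IsSummand L.ρ (σ.tprod σ') ∧ IsSummand ρ (L.ρ.tprod ν) :=
  IsSummand.exists_indecomposable hρ (σ.tprod σ') h

theorem smul_comp_add_smul_comp {k Γ B C D : Type*} [Field k] [Group Γ]
    [AddCommMonoid B] [Module k B] [AddCommMonoid C] [Module k C] [AddCommMonoid D] [Module k D]
    {σ : Representation k Γ B} {τ : Representation k Γ C} {ν : Representation k Γ D}
    (a : IntertwiningMap σ τ) (b : IntertwiningMap τ σ)
    (a' : IntertwiningMap σ ν) (b' : IntertwiningMap ν σ) {c d : k} (hcd : c * d = 1)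
    (h : b.comp a + b'.comp a' = d • .id σ) :
    (c • b).comp a + (c • b').comp a' = .id σ := by
  ext x
  have h1 : b (a x) + b' (a' x) = d • x := DFunLike.congr_fun h x
  change c • b (a x) + c • b' (a' x) = x
  rw [← smul_add, h1, smul_smul, hcd, one_smul]

/-! ### Fusion rules modulo projectives -/

section Fusion

variable {k : Type u} [Field k] {p : ℕ} [CharP k p]

theorem isSummand_formRep_succ {d : ℕ} (hd : ((d + 1 : ℕ) : k) ≠ 0) :
    IsSummand (formRep k p (d + 1)) ((formRep k p d).tprod (formRep k p 1)) := by
  refine ⟨adjointMap (jacMap k p d 0), (-((d + 1 : ℕ) : k))⁻¹ • mulMap k p d 1, ?_⟩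
  ext1
  ext1 f
  change (-((d + 1 : ℕ) : k))⁻¹ • mulMap k p d 1 (adjointMap (jacMap k p d 0) f) = f
  rw [mulMap_adjointMap_jacMap, smul_smul, inv_mul_cancel₀ (neg_ne_zero.2 hd), one_smul]

theorem isSummand_formRep_pred {d : ℕ} (hd : ((d + 2 : ℕ) : k) ≠ 0) :
    IsSummand (formRep k p d) ((formRep k p (d + 1)).tprod (formRep k p 1)) := by
  refine ⟨adjointMap (mulMap k p d 1), ((d + 2 : ℕ) : k)⁻¹ • jacMap k p d 0, ?_⟩
  ext1
  ext1 f
  change ((d + 2 : ℕ) : k)⁻¹ • jacMap k p d 0 (adjointMap (mulMap k p d 1) f) = f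
  rw [jacMap_adjointMap_mulMap, smul_smul, inv_mul_cancel₀ hd, one_smul]

theorem exists_tensor_forms_one_decomposition {d : ℕ} (hd : ((d + 2 : ℕ) : k) ≠ 0) :
    ∃ (a : IntertwiningMap ((formRep k p (d + 1)).tprod (formRep k p 1)) (formRep k p (d + 2)))
      (b : IntertwiningMap (formRep k p (d + 2)) ((formRep k p (d + 1)).tprod (formRep k p 1)))
      (a' : IntertwiningMap ((formRep k p (d + 1)).tprod (formRep k p 1)) (formRep k p d))
      (b' : IntertwiningMap (formRep k p d) ((formRep k p (d + 1)).tprod (formRep k p 1))),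
      b.comp a + b'.comp a' = .id _ := by
  refine ⟨mulMap k p (d + 1) 1,
    ((d + 2 : ℕ) : k)⁻¹ • (-1 : k) • adjointMap (jacMap k p (d + 1) 0), jacMap k p d 0,
    ((d + 2 : ℕ) : k)⁻¹ • adjointMap (mulMap k p d 1), ?_⟩
  exact smul_comp_add_smul_comp _ _ _ _ (inv_mul_cancel₀ hd) (tensor_forms_one_decomposition d)

variable (k) in
/-- The constant form `1`. -/
def formOne : Forms k 0 := ⟨1, MvPolynomial.isHomogeneous_one _ _⟩

theorem formRep_zero_apply (g : G p) (f : Forms k 0) : formRep k p 0 g f = f := by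
  have hf : f.1.IsHomogeneous 0 := f.2
  ext1
  rw [formRep_apply_coe, MvPolynomial.totalDegree_eq_zero_iff_eq_C.1
    (Nat.le_zero.1 hf.totalDegree_le), subst_C]

theorem exists_eq_smul_formOne (f : Forms k 0) : ∃ c : k, f = c • formOne k := by
  have hf : f.1.IsHomogeneous 0 := f.2
  refine ⟨MvPolynomial.coeff 0 f.1, ?_⟩
  ext1
  conv_lhs => rw [MvPolynomial.totalDegree_eq_zero_iff_eq_C.1
    (Nat.le_zero.1 hf.totalDegree_le)]
  rw [Submodule.coe_smul, formOne, MvPolynomial.smul_eq_C_mul, mul_one]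

/-- The map `a ↦ a ⊗ 1`. -/
def tensorFormOne {A : Type*} [AddCommGroup A] [Module k A] (ρ : Representation k (G p) A) :
    IntertwiningMap ρ (ρ.tprod (formRep k p 0)) where
  toLinearMap := (TensorProduct.mk k A (Forms k 0)).flip (formOne k)
  isIntertwining' g := by
    ext a
    change ρ g a ⊗ₜ[k] formOne k = ρ g a ⊗ₜ[k] formRep k p 0 g (formOne k)
    rw [formRep_zero_apply]

theorem nonempty_equiv_tensor_zero {A : Type*} [AddCommGroup A] [Module k A]
    (ρ : Representation k (G p) A) :
    Nonempty (Representation.Equiv ρ (ρ.tprod (formRep k p 0))) := by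
  refine ⟨(tensorFormOne ρ).ofBijective ⟨?_, ?_⟩⟩
  · have h : Function.LeftInverse (TensorProduct.lift (LinearMap.flip
        (((MvPolynomial.aeval fun _ : Fin 2 => (0 : k)).toLinearMap ∘ₗ
          (Forms k 0).subtype).smulRight (LinearMap.id : A →ₗ[k] A)))) (tensorFormOne ρ) := by
      intro a
      change MvPolynomial.aeval (fun _ : Fin 2 => (0 : k)) (1 : MvPolynomial (Fin 2) k) • a = a
      rw [map_one, one_smul]
    exact h.injective
  · intro t
    induction t using TensorProduct.induction_on with
    | zero => exact ⟨0, map_zero _⟩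
    | add x y hx hy =>
      obtain ⟨a, rfl⟩ := hx
      obtain ⟨b, rfl⟩ := hy
      exact ⟨a + b, map_add _ _ _⟩
    | tmul a f =>
      obtain ⟨c, rfl⟩ := exists_eq_smul_formOne f
      refine ⟨c • a, ?_⟩
      change (c • a) ⊗ₜ[k] formOne k = _
      rw [TensorProduct.smul_tmul]

theorem natCast_ne_zero_of_lt {m : ℕ} (h0 : 0 < m) (h : m < p) : (m : k) ≠ 0 := by
  rw [Ne, CharP.cast_eq_zero_iff k p]
  exact fun h' => absurd (Nat.le_of_dvd h0 h') (by omega)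

variable [Fact p.Prime]

/-- The group order is 0 in k, while the dimension d + 1 is not. -/
theorem not_isTraceProjective_formRep {d : ℕ} (hd : d + 1 < p) :
    ¬ IsTraceProjective (formRep k p d) := by
  intro h
  have := h.finrank_eq_zero (card_eq_zero p k)
  rw [finrank_forms] at this
  exact natCast_ne_zero_of_lt (Nat.succ_pos d) hd this

theorem eq_of_isSummand {d e : ℕ} (he : e < p) (h : IsSummand (formRep k p d) (formRep k p e)) :
    d = e := by
  have := isIrreducible_formRep (k := k) he
  obtain ⟨f⟩ := h.nonempty_equiv
  have := f.toLinearEquiv.finrank_eq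
  rw [finrank_forms, finrank_forms] at this
  omega

/-- The nonprojective indecomposable summands of `σ` are forms of degree less than `p - 1`. -/
def HasSimpleSummands {B : Type u} [AddCommMonoid B] [Module k B] (σ : Representation k (G p) B) :
    Prop :=
  ∀ M : Rep.{u} k (G p), FiniteDimensional k M.V → IsIndecomposable k[G p] M.ρ.asModule →
    ¬ IsTraceProjective M.ρ → IsSummand M.ρ σ →
    ∃ d, d + 1 < p ∧ Nonempty (Representation.Equiv M.ρ (formRep k p d))

theorem HasSimpleSummands.of_isSummand {B C : Type u} [AddCommMonoid B] [Module k B]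
    [AddCommMonoid C] [Module k C] {σ : Representation k (G p) B} {τ : Representation k (G p) C}
    (hσ : HasSimpleSummands σ) (h : IsSummand τ σ) : HasSimpleSummands τ :=
  fun M h1 h2 h3 h4 => hσ M h1 h2 h3 (h4.trans h)

/-- For d = p - 1 the condition is vacuous, since the Steinberg module is projective. -/
theorem hasSimpleSummands_formRep [IsAlgClosed k] {d : ℕ} (hd : d < p) :
    HasSimpleSummands (formRep k p d) := by
  intro M _ hM hproj hs
  have := isIrreducible_formRep (k := k) hd
  have : Nontrivial M.V := hM.1
  obtain ⟨e⟩ := hs.nonempty_equiv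
  refine ⟨d, lt_of_le_of_ne hd fun h => hproj ?_, ⟨e⟩⟩
  obtain rfl : d = p - 1 := by omega
  exact e.isSummand.isTraceProjective isTraceProjective_formRep

/-- A nonprojective summand M lies in L ⊗ V₂ for an indecomposable summand L, which is nonprojective
by the tensor ideal property. So L consists of forms of degree d with d + 1 < p, the range where the
Clebsch–Gordan splitting holds. -/
theorem HasSimpleSummands.tensor_forms_one [IsAlgClosed k] {B C : Type u} [AddCommGroup B]
    [Module k B] [FiniteDimensional k B] [AddCommGroup C] [Module k C] [FiniteDimensional k C]
    {σ : Representation k (G p) B} {τ : Representation k (G p) C}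
    (hσ : HasSimpleSummands (σ.tprod τ)) :
    HasSimpleSummands ((σ.tprod τ).tprod (formRep k p 1)) := by
  intro M hM1 hM2 hM3 hM4
  obtain ⟨L, hL1, hL2, hL3, hL4⟩ := IsSummand.exists_indecomposable_tprod hM2 σ τ hM4
  obtain ⟨d, hd, ⟨e⟩⟩ := hσ L hL1 hL2
    (fun h => hM3 (hL4.isTraceProjective (h.tprod _))) hL3
  have hM : IsSummand M.ρ ((formRep k p d).tprod (formRep k p 1)) :=
    hL4.trans (e.isSummand.tensor (.refl _))
  cases d with
  | zero =>
    obtain ⟨e'⟩ := nonempty_equiv_tensor_zero (formRep k p 1)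
    exact hasSimpleSummands_formRep hd M hM1 hM2 hM3
      ((hM.trans (Representation.TensorProduct.comm _ _).isSummand).trans e'.symm.isSummand)
  | succ d =>
    obtain ⟨a, b, a', b', hab⟩ :=
      exists_tensor_forms_one_decomposition (k := k) (p := p) (d := d)
        (natCast_ne_zero_of_lt (by omega) hd)
    rcases hM.or_of_add_eq_id hM2 a b a' b' hab with h | h
    · exact hasSimpleSummands_formRep hd M hM1 hM2 hM3 h
    · exact hasSimpleSummands_formRep (by omega) M hM1 hM2 hM3 h

/-- Induction on n: the forms of degree n + 1 are a summand of those of degree n tensored with V₂,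
so the claim is inherited by associativity. -/
theorem hasSimpleSummands_tprod [IsAlgClosed k] {m n : ℕ} (hm : m < p) (hn : n < p) :
    HasSimpleSummands ((formRep k p m).tprod (formRep k p n)) := by
  induction n with
  | zero =>
    obtain ⟨e⟩ := nonempty_equiv_tensor_zero (formRep k p m)
    exact (hasSimpleSummands_formRep hm).of_isSummand e.symm.isSummand
  | succ n ih =>
    have h1 := (ih (by omega)).tensor_forms_one
    refine h1.of_isSummand (((IsSummand.refl _).tensor
      (isSummand_formRep_succ (natCast_ne_zero_of_lt (by omega) hn))).trans
      (Representation.TensorProduct.assoc _ _ _).symm.isSummand)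

/-- A common neighbour in the fusion graph. -/
theorem exists_common_summand [IsAlgClosed k] {m n e : ℕ} (hm : m < p) (hn : n < p)
    (he : e + 1 < p) (h : IsSummand (formRep k p e)
      ((formRep k p m).tprod ((formRep k p n).tprod (formRep k p n)))) :
    ∃ l, l + 1 < p ∧ IsSummand (formRep k p l) ((formRep k p m).tprod (formRep k p n)) ∧
      IsSummand (formRep k p e) ((formRep k p l).tprod (formRep k p n)) := by
  have := isIrreducible_formRep (k := k) (p := p) (d := e) (by omega)
  have h' := h.trans (Representation.TensorProduct.assoc _ _ _).symm.isSummand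
  obtain ⟨L, hL1, hL2, hL3, hL4⟩ :=
    IsSummand.exists_indecomposable_tprod (isIndecomposable_of_isIrreducible _) _ _ h'
  -- If L were projective, so would be the forms of degree e, a summand of L tensored with the forms
  -- of degree n.
  obtain ⟨l, hl, ⟨f⟩⟩ := hasSimpleSummands_tprod hm hn L hL1 hL2
    (fun hp => not_isTraceProjective_formRep he (hL4.isTraceProjective (hp.tprod _))) hL3
  exact ⟨l, hl, f.symm.isSummand.trans hL3, hL4.trans (f.isSummand.tensor (.refl _))⟩

end Fusion

/-! ### The summands V₁ and V₃ of a tensor square -/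

section TwoSteps

variable {k : Type u} [Field k] {p : ℕ} [CharP k p] [Fact p.Prime]

open MvPolynomial (C X pderiv)

/-- The constant form acts as the identity, whose trace is n + 1, nonzero in k. -/
theorem isSummand_formRep_zero {n : ℕ} (hn : n + 1 < p) :
    IsSummand (formRep k p 0) ((formRep k p n).tprod (formRep k p n)) := by
  have := isIrreducible_formRep (k := k) (p := p) (d := 0) (by omega)
  obtain ⟨e⟩ := nonempty_equiv_dual (k := k) (p := p) (d := n) (by omega)
  refine isSummand_tprod_of_trace_ne_zero e (mulMap k p n 0) (formOne k) (formOne k) ?_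
  have h : (toLinHom (mulMap k p n 0) (formOne k) : Module.End k (Forms k n)) = 1 := by
    ext1 f
    ext1
    rw [toLinHom_apply, mulMap_coe]
    simp [formOne]
  change LinearMap.trace k (Forms k n) ((toLinHom (mulMap k p n 0) (formOne k) :
    Module.End k (Forms k n)) * (toLinHom (mulMap k p n 0) (formOne k) :
    Module.End k (Forms k n))) ≠ 0
  rw [h, mul_one, LinearMap.trace_one, finrank_forms]
  exact natCast_ne_zero_of_lt (by omega) hn

theorem trace_of_eigenbasis {V ι : Type*} [AddCommGroup V] [Module k V] [Fintype ι]
    (b : Module.Basis ι k V) (T : Module.End k V) (c : ι → k) (h : ∀ i, T (b i) = c i • b i) :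
    LinearMap.trace k V T = ∑ i, c i := by
  classical
  rw [LinearMap.trace_eq_matrix_trace k b, Matrix.trace]
  refine Finset.sum_congr rfl fun i _ => ?_
  rw [Matrix.diag_apply, LinearMap.toMatrix_apply, h, map_smul]
  simp

/-- The factor 6 avoids dividing in k. -/
theorem six_mul_sum (x : k) (m : ℕ) :
    6 * ∑ i ∈ Finset.range m, (x - i) * (i + 1) =
      6 * x * m + 3 * (x - 1) * m * (m - 1) - m * (m - 1) * (2 * m - 1) := by
  induction m with
  | zero => simp
  | succ m ih =>
    rw [Finset.sum_range_succ, mul_add, ih]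
    push_cast
    ring

/-- The Jacobians with Y² and X² are 2Y ∂_X and -2X ∂_Y, a raising and a lowering operator, so their
product is diagonal on monomials. -/
theorem jac_jac_mono {d i : ℕ} (hi : i ≤ d) :
    jac (jac (mono k d i).1 (X 1 ^ 2)) (X 0 ^ 2) =
      (-4 * ((d - i) * (i + 1)) : k) • (mono k d i).1 := by
  set f : MvPolynomial (Fin 2) k := (mono k d i).1 with hf
  have h0 : X 0 * pderiv 0 f = C ((d : k) - i) * f := by
    rw [hf, mono_coe' hi, MvPolynomial.X_mul_pderiv_monomial, expo_zero,
      ← MvPolynomial.smul_eq_C_mul, ← Nat.cast_sub hi, Nat.cast_smul_eq_nsmul]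
  have h1 : X 1 * pderiv 1 f = C (i : k) * f := by
    rw [hf, mono_coe' hi, MvPolynomial.X_mul_pderiv_monomial, expo_one,
      ← MvPolynomial.smul_eq_C_mul, Nat.cast_smul_eq_nsmul]
  have e1 : jac f (X 1 ^ 2) = 2 * (X 1 * pderiv 0 f) := by
    simp [jac]
    ring
  have e2 : ∀ h : MvPolynomial (Fin 2) k, jac h (X 0 ^ 2) = -(2 * (X 0 * pderiv 1 h)) := by
    intro h
    simp [jac]
    ring
  have e3 : pderiv 1 (X 0 * pderiv 0 f) = X 0 * pderiv 1 (pderiv 0 f) := by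
    rw [Derivation.leibniz, MvPolynomial.pderiv_X_of_ne (by decide)]
    simp
  have e4 : X 0 * pderiv 1 (pderiv 0 f) = C ((d : k) - i) * pderiv 1 f := by
    rw [← e3, h0, MvPolynomial.pderiv_C_mul]
  have e5 : pderiv 1 (2 * (X 1 * pderiv 0 f)) =
      2 * (pderiv 0 f + X 1 * pderiv 1 (pderiv 0 f)) := by
    rw [two_mul, map_add, Derivation.leibniz, MvPolynomial.pderiv_X_self]
    simp only [smul_eq_mul, mul_one]
    ring
  rw [e1, e2, e5, MvPolynomial.smul_eq_C_mul]
  simp only [map_mul, map_add, map_sub, map_neg, map_one, map_natCast] at h0 h1 e4 ⊢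
  have h4 : (C (4 : k) : MvPolynomial (Fin 2) k) = 4 := map_ofNat C 4
  rw [h4]
  linear_combination (-4 : MvPolynomial (Fin 2) k) * h0 - 4 * X 1 * e4 -
    4 * ((d : MvPolynomial (Fin 2) k) - i) * h1

/-- Quadratic forms act by the Jacobian. Six times the trace of the product of the actions of X² and
Y² is -4(n+1)(n+2)(n+3), whose factors are all prime to p since n + 3 < p. -/
theorem isSummand_formRep_two {n : ℕ} (hn : n + 3 < p) :
    IsSummand (formRep k p 2) ((formRep k p (n + 1)).tprod (formRep k p (n + 1))) := by
  have := isIrreducible_formRep (k := k) (p := p) (d := 2) (by omega)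
  obtain ⟨e⟩ := nonempty_equiv_dual (k := k) (p := p) (d := n + 1) (by omega)
  refine isSummand_tprod_of_trace_ne_zero e (jacMap k p n 1) (mono k 2 0) (mono k 2 2) ?_
  intro h0
  set T : Module.End k (Forms k (n + 1)) :=
    (toLinHom (jacMap k p n 1) (mono k 2 0) : Module.End k (Forms k (n + 1))) *
      (toLinHom (jacMap k p n 1) (mono k 2 2) : Module.End k (Forms k (n + 1))) with hT
  have h1 := trace_of_eigenbasis (monoBasis k (n + 1)) T
    (fun i => -4 * (((n + 1 : ℕ) - (i : ℕ)) * ((i : ℕ) + 1))) (fun i => by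
      rw [monoBasis_apply]
      ext1
      rw [Submodule.coe_smul, ← jac_jac_mono (by omega), hT, Module.End.mul_apply]
      change jac (jac (mono k (n + 1) i : MvPolynomial (Fin 2) k)
        (mono k 2 2 : MvPolynomial (Fin 2) k)) (mono k 2 0 : MvPolynomial (Fin 2) k) = _
      rw [mono_coe (d := 2) le_rfl, mono_coe (d := 2) (Nat.zero_le _)]
      simp)
  rw [← Finset.mul_sum, Fin.sum_univ_eq_sum_range
    (fun i => (((n + 1 : ℕ) : k) - (i : ℕ)) * ((i : ℕ) + 1))] at h1
  have h2 : LinearMap.trace k _ T = 0 := h0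
  have h3 := six_mul_sum (k := k) ((n + 1 : ℕ) : k) (n + 1 + 1)
  rw [h2] at h1
  have h4 : (((2 * 2 * (n + 1) * (n + 2) * (n + 3) : ℕ)) : k) = 0 := by
    push_cast at h1 h3 ⊢
    linear_combination (6 : k) * h1 - 4 * h3
  rw [CharP.cast_eq_zero_iff k p] at h4
  have hp : p.Prime := Fact.out
  simp only [hp.dvd_mul] at h4
  have hle : ∀ m, 0 < m → p ∣ m → p ≤ m := fun m h h' => Nat.le_of_dvd h h'
  rcases h4 with (((h | h) | h) | h) | h <;> have := hle _ (by omega) h <;> omega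

/-- V₂ ⊗ V₂ splits as V₃ ⊕ V₁, and the summand V₁ contributes only the forms of degree m, excluded
by e ≠ m. -/
theorem isSummand_tensor_two {m e : ℕ} (hm : m < p) (he : e < p) (hme : e ≠ m) (hp : 2 < p)
    (h : IsSummand (formRep k p e)
      (((formRep k p m).tprod (formRep k p 1)).tprod (formRep k p 1))) :
    IsSummand (formRep k p e) ((formRep k p m).tprod (formRep k p 2)) := by
  have := isIrreducible_formRep (k := k) he
  have h' := h.trans (Representation.TensorProduct.assoc _ _ _).isSummand
  obtain ⟨a, b, a', b', hab⟩ :=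
    exists_tensor_forms_one_decomposition (k := k) (p := p) (d := 0)
      (natCast_ne_zero_of_lt (by omega) hp)
  rcases h'.or_of_add_eq_id (isIndecomposable_of_isIrreducible _)
    (a.lTensor (formRep k p m)) (b.lTensor _) (a'.lTensor (formRep k p m)) (b'.lTensor _) (by
      have : (b.comp a + b'.comp a').lTensor (formRep k p m) =
          (IntertwiningMap.id _).lTensor (formRep k p m) := by rw [hab]
      rw [IntertwiningMap.lTensor_id, IntertwiningMap.lTensor_add] at this
      rw [← this]
      congr 1 <;> (ext; rfl)) with h1 | h1
  · exact h1
  · obtain ⟨f⟩ := nonempty_equiv_tensor_zero (formRep k p m)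
    exact absurd (eq_of_isSummand hm (h1.trans f.symm.isSummand)) hme

theorem isSummand_tensor_two_up {m : ℕ} (hm : m + 3 < p) :
    IsSummand (formRep k p (m + 2)) ((formRep k p m).tprod (formRep k p 2)) :=
  isSummand_tensor_two (by omega) (by omega) (by omega) (by omega)
    ((isSummand_formRep_succ (natCast_ne_zero_of_lt (by omega) (by omega))).trans
      ((isSummand_formRep_succ (natCast_ne_zero_of_lt (by omega) (by omega))).tensor (.refl _)))

theorem isSummand_tensor_two_down {m : ℕ} (hm : m + 3 < p) :
    IsSummand (formRep k p m) ((formRep k p (m + 2)).tprod (formRep k p 2)) :=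
  isSummand_tensor_two (by omega) (by omega) (by omega) (by omega)
    ((isSummand_formRep_pred (natCast_ne_zero_of_lt (by omega) (by omega))).trans
      ((isSummand_formRep_pred (natCast_ne_zero_of_lt (by omega) (by omega))).tensor (.refl _)))

end TwoSteps

/-! ### Parity from the central element -1 -/

section Parity

variable {k : Type u} [Field k] {p : ℕ} [CharP k p] [Fact p.Prime]

theorem formRep_neg_one (d : ℕ) (f : Forms k d) :
    formRep k p d (-1) f = (-1 : k) ^ d • f := by
  have : formRep k p d (-1) = (-1 : k) ^ d • LinearMap.id := by
    refine (monoBasis k d).ext fun i => ?_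
    rw [monoBasis_apply]
    ext1
    rw [formRep_apply_coe, mono_coe (by omega), map_mul, map_pow, map_pow, subst_X, subst_X,
      LinearMap.smul_apply, LinearMap.id_apply, Submodule.coe_smul, mono_coe (by omega)]
    have h00 : entry k p (-1) 0 0 = -1 := by simp [entry]
    have h01 : entry k p (-1) 0 1 = 0 := by simp [entry]
    have h10 : entry k p (-1) 1 0 = 0 := by simp [entry]
    have h11 : entry k p (-1) 1 1 = -1 := by simp [entry]
    rw [h00, h01, h10, h11, MvPolynomial.smul_eq_C_mul]
    have hd : (-1 : MvPolynomial (Fin 2) k) ^ d = (-1) ^ (d - i) * (-1) ^ (i : ℕ) := by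
      rw [← pow_add]; congr 1; omega
    simp only [map_neg, map_one, map_zero, zero_mul, zero_add, add_zero, map_pow, hd, mul_pow]
    ring
  rw [this]
  rfl

/-- The central element -1 acts by (-1) ^ l on the summand and by (-1) ^ (m + n) on the product, and
the two signs differ in k when p ≠ 2. -/
theorem even_iff_of_isSummand {l m n : ℕ} (hp : p ≠ 2)
    (h : IsSummand (formRep k p l) ((formRep k p m).tprod (formRep k p n))) :
    Even l ↔ Even (m + n) := by
  obtain ⟨f, g, hfg⟩ := h
  obtain ⟨x, hx⟩ := exists_ne (0 : Forms k l)
  have h1 := IntertwiningMap.isIntertwining _ _ f (-1) x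
  have h2 : ∀ t, ((formRep k p m).tprod (formRep k p n)) (-1) t = (-1 : k) ^ (m + n) • t := by
    intro t
    induction t using TensorProduct.induction_on with
    | zero => simp
    | add x y hx hy => rw [map_add, hx, hy, smul_add]
    | tmul a b =>
      rw [Representation.tprod_apply, TensorProduct.map_tmul, formRep_neg_one, formRep_neg_one,
        TensorProduct.smul_tmul_smul, pow_add]
  rw [formRep_neg_one, map_smul, h2] at h1
  have h3 : (-1 : k) ^ l = (-1) ^ (m + n) := by
    have h3 := congrArg g h1
    rw [map_smul, map_smul, show g (f x) = x from DFunLike.congr_fun hfg x] at h3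
    exact smul_left_injective k hx h3
  have h4 : (-1 : k) ≠ 1 := by
    have := Ring.neg_one_ne_one_of_char_ne_two (R := k) (by rwa [ringChar.eq k p])
    exact this
  have h5 : ∀ a : ℕ, Even a ↔ (-1 : k) ^ a = 1 := by
    intro a
    rcases Nat.even_or_odd a with ha | ha
    · simp [ha, ha.neg_one_pow]
    · simp [ha.neg_one_pow, Nat.not_even_iff_odd.2 ha, h4]
  rw [h5, h5, h3]

end Parity

/-! ### Positive multiplicity means being a summand -/

section Multiplicity

theorem finrank_pi_le {k R M W : Type*} [Field k] [Ring R] [Algebra k R]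
    [AddCommGroup M] [Module k M] [Module R M] [IsScalarTower k R M] [FiniteDimensional k M]
    [AddCommGroup W] [Module k W] [Module R W] [IsScalarTower k R W] [FiniteDimensional k W]
    {m : ℕ} (f : (Fin m → M) →ₗ[R] W) (hf : Function.Injective f) :
    m * Module.finrank k M ≤ Module.finrank k W := by
  have := LinearMap.finrank_le_finrank_of_injective (f := f.restrictScalars k) hf
  simpa [Module.finrank_pi_fintype] using this

/-- The bound is needed because the supremum of an unbounded set of naturals is 0 by default. -/
theorem bddAbove_multiplicity (k : Type*) {R : Type u} {M W : Type v} [Field k] [Ring R]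
    [Algebra k R] [AddCommGroup M] [Module k M] [Module R M] [IsScalarTower k R M]
    [FiniteDimensional k M] [Nontrivial M]
    [AddCommGroup W] [Module k W] [Module R W] [IsScalarTower k R W] [FiniteDimensional k W] :
    BddAbove {m : ℕ | ∃ A B : Submodule R W, IsCompl A B ∧ Nonempty ((Fin m → M) ≃ₗ[R] A)} := by
  refine ⟨Module.finrank k W, ?_⟩
  rintro m ⟨A, B, -, ⟨e⟩⟩
  have h1 := finrank_pi_le (k := k) (A.subtype ∘ₗ e.toLinearMap)
    (A.injective_subtype.comp e.injective)
  have h2 : 0 < Module.finrank k M := Module.finrank_pos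
  nlinarith

theorem multiplicity_pos_iff (k : Type*) {R : Type u} {M W : Type v} [Field k] [Ring R]
    [Algebra k R] [AddCommGroup M] [Module k M] [Module R M] [IsScalarTower k R M]
    [FiniteDimensional k M] [Nontrivial M]
    [AddCommGroup W] [Module k W] [Module R W] [IsScalarTower k R W] [FiniteDimensional k W] :
    0 < multiplicity R M W ↔ ∃ (f : M →ₗ[R] W) (g : W →ₗ[R] M), g ∘ₗ f = .id := by
  have hb := bddAbove_multiplicity k (R := R) (M := M) (W := W)
  constructor
  · intro h
    obtain ⟨A, B, hAB, ⟨e⟩⟩ := Nat.sSup_mem (s := {m : ℕ | ∃ A B : Submodule R W, IsCompl A B ∧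
      Nonempty ((Fin m → M) ≃ₗ[R] A)}) ⟨0, ⊥, ⊤, isCompl_bot_top,
        ⟨LinearEquiv.ofSubsingleton _ _⟩⟩ hb
    let i : Fin (multiplicity R M W) := ⟨0, h⟩
    let e' : (Fin (multiplicity R M W) → M) ≃ₗ[R] A := e
    refine ⟨A.subtype ∘ₗ e'.toLinearMap ∘ₗ LinearMap.single R (fun _ => M) i,
      LinearMap.proj i ∘ₗ e'.symm.toLinearMap ∘ₗ A.projectionOnto B hAB, ?_⟩
    ext x
    simp
  · rintro ⟨f, g, hfg⟩
    have hfg' : Function.LeftInverse g f := fun x => LinearMap.congr_fun hfg x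
    refine lt_of_lt_of_le Nat.zero_lt_one (le_csSup hb ⟨LinearMap.range f, LinearMap.ker g, ?_,
      ⟨(LinearEquiv.funUnique (Fin 1) R M).trans (LinearEquiv.ofInjective f hfg'.injective)⟩⟩)
    constructor
    · rw [Submodule.disjoint_def]
      rintro _ ⟨x, rfl⟩ hx
      rw [LinearMap.mem_ker, hfg' x] at hx
      rw [hx, map_zero]
    · rw [codisjoint_iff, eq_top_iff]
      intro x _
      exact Submodule.mem_sup.2 ⟨f (g x), ⟨g x, rfl⟩, x - f (g x), by
        rw [LinearMap.mem_ker, map_sub, hfg', sub_self], by abel⟩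

theorem exists_retract_iff_isSummand {k Γ A B : Type*} [Field k] [Group Γ]
    [AddCommGroup A] [Module k A] [AddCommGroup B] [Module k B]
    {ρ : Representation k Γ A} {σ : Representation k Γ B} :
    (∃ (f : ρ.asModule →ₗ[k[Γ]] σ.asModule) (g : σ.asModule →ₗ[k[Γ]] ρ.asModule),
      g ∘ₗ f = .id) ↔ IsSummand ρ σ := by
  constructor
  · rintro ⟨f, g, h⟩
    refine ⟨(IntertwiningMap.equivLinearMapAsModule ρ σ).symm f,
      (IntertwiningMap.equivLinearMapAsModule σ ρ).symm g, ?_⟩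
    ext x
    exact LinearMap.congr_fun h x
  · rintro ⟨f, g, h⟩
    refine ⟨IntertwiningMap.equivLinearMapAsModule ρ σ f,
      IntertwiningMap.equivLinearMapAsModule σ ρ g, ?_⟩
    ext x
    exact DFunLike.congr_fun h x

theorem multiplicity_asModule_pos_iff {k Γ : Type*} {A B : Type v} [Field k] [Group Γ]
    [AddCommGroup A] [Module k A] [FiniteDimensional k A] [Nontrivial A]
    [AddCommGroup B] [Module k B] [FiniteDimensional k B]
    (ρ : Representation k Γ A) (σ : Representation k Γ B) :
    0 < multiplicity k[Γ] ρ.asModule σ.asModule ↔ IsSummand ρ σ := by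
  rw [← exists_retract_iff_isSummand]
  have : FiniteDimensional k ρ.asModule := ‹FiniteDimensional k A›
  have : FiniteDimensional k σ.asModule := ‹FiniteDimensional k B›
  have : Nontrivial ρ.asModule := ‹Nontrivial A›
  exact multiplicity_pos_iff k

end Multiplicity

/-! ### The states of the walk -/

section States

variable {k : Type u} [Field k] {p : ℕ}

namespace NonprojIndec

instance (U : NonprojIndec k p) : FiniteDimensional k U.rep.V := (Quotient.out U).2.1

theorem isIndecomposable_rep (U : NonprojIndec k p) :
    IsIndecomposable k[G p] U.rep.ρ.asModule := (Quotient.out U).2.2.1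

instance (U : NonprojIndec k p) : Nontrivial U.rep.V := U.isIndecomposable_rep.1

theorem not_isTraceProjective_rep [Fact p.Prime] (U : NonprojIndec k p) :
    ¬ IsTraceProjective U.rep.ρ :=
  fun h => (Quotient.out U).2.2.2 h.projective

theorem eq_of_equiv {U U' : NonprojIndec k p} (e : Representation.Equiv U.rep.ρ U'.rep.ρ) :
    U = U' :=
  Quotient.out_equiv_out.1 ⟨asModuleEquivOfEquiv e⟩

theorem nonempty_rep_equiv (M : NonprojIndecModule k p) :
    Nonempty (Representation.Equiv (rep (Quotient.mk _ M : NonprojIndec k p)).ρ M.1.ρ) := by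
  obtain ⟨e⟩ : Nonempty ((rep (Quotient.mk _ M : NonprojIndec k p)).ρ.asModule ≃ₗ[k[G p]]
    M.1.ρ.asModule) := Quotient.mk_out M
  exact ⟨equivOfAsModuleEquiv e⟩

variable [CharP k p]

theorem tensorMultiplicity_pos_iff (n : ℕ) (U M : NonprojIndec k p) :
    0 < U.tensorMultiplicity n M ↔ IsSummand M.rep.ρ (U.rep.ρ.tprod (V k p n)) :=
  multiplicity_asModule_pos_iff _ _

variable [Fact p.Prime]

/-- The class of the forms of degree `d`. -/
def ofForms (k : Type u) [Field k] {p : ℕ} [CharP k p] [Fact p.Prime] (d : ℕ) (hd : d + 1 < p) :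
    NonprojIndec k p :=
  Quotient.mk _ ⟨Rep.of (formRep k p d), inferInstanceAs (FiniteDimensional k (Forms k d)),
    have := isIrreducible_formRep (k := k) (p := p) (d := d) (by omega)
    isIndecomposable_of_isIrreducible (formRep k p d),
    fun h => not_isTraceProjective_formRep hd (isTraceProjective_of_projective h)⟩

theorem nonempty_ofForms_rep_equiv {d : ℕ} (hd : d + 1 < p) :
    Nonempty (Representation.Equiv (ofForms k d hd).rep.ρ (formRep k p d)) :=
  nonempty_rep_equiv _

theorem eq_ofForms {U : NonprojIndec k p} {d : ℕ} (hd : d + 1 < p)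
    (e : Representation.Equiv U.rep.ρ (formRep k p d)) : U = ofForms k d hd := by
  obtain ⟨f⟩ := nonempty_ofForms_rep_equiv (k := k) hd
  exact eq_of_equiv (e.trans f.symm)

theorem dim_ofForms {d : ℕ} (hd : d + 1 < p) : (ofForms k d hd).dim = d + 1 := by
  obtain ⟨f⟩ := nonempty_ofForms_rep_equiv (k := k) hd
  rw [dim, f.toLinearEquiv.finrank_eq, finrank_forms]

theorem ofForms_mem_states {d : ℕ} (hd : d + 1 < p) : ofForms k d hd ∈ states k p := by
  obtain ⟨f⟩ := nonempty_ofForms_rep_equiv (k := k) hd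
  have := isIrreducible_formRep (k := k) (p := p) (d := d) (by omega)
  exact (irreducible_iff_isSimpleModule_asModule _).1 (isIrreducible_of_equiv f)

/-- The classification leaves degrees d < p, and d = p - 1 drops out because the Steinberg module is
projective. -/
theorem exists_eq_ofForms [IsAlgClosed k] {U : NonprojIndec k p} (hU : U ∈ states k p) :
    ∃ (d : ℕ) (hd : d + 1 < p), U = ofForms k d hd := by
  have : Representation.IsIrreducible U.rep.ρ := (irreducible_iff_isSimpleModule_asModule _).2 hU
  obtain ⟨d, hd, ⟨e⟩⟩ := exists_equiv_formRep (p := p) U.rep.ρ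
  have hd' : d + 1 < p := by
    by_contra h
    obtain rfl : d = p - 1 := by omega
    exact U.not_isTraceProjective_rep (e.isSummand.isTraceProjective isTraceProjective_formRep)
  exact ⟨d, hd', eq_ofForms hd' e⟩

theorem finite_states [IsAlgClosed k] : (states k p).Finite := by
  refine Set.Finite.subset (Set.finite_range fun i : Fin (p - 1) =>
    ofForms k (p := p) i (by omega)) fun U hU => ?_
  obtain ⟨d, hd, rfl⟩ := exists_eq_ofForms hU
  exact ⟨⟨d, by omega⟩, rfl⟩

theorem tensorMultiplicity_ofForms_pos_iff (n : ℕ) {d e : ℕ} (hd : d + 1 < p) (he : e + 1 < p) :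
    0 < (ofForms k d hd).tensorMultiplicity n (ofForms k e he) ↔
      IsSummand (formRep k p e) ((formRep k p d).tprod (formRep k p (n - 1))) := by
  obtain ⟨f⟩ := nonempty_ofForms_rep_equiv (k := k) hd
  obtain ⟨g⟩ := nonempty_ofForms_rep_equiv (k := k) he
  rw [tensorMultiplicity_pos_iff]
  constructor
  · intro h
    exact (g.symm.isSummand.trans h).trans (f.isSummand.tensor (.refl _))
  · intro h
    exact (g.isSummand.trans h).trans (f.symm.isSummand.tensor (.refl _))

theorem mem_states_of_tensorMultiplicity_pos [IsAlgClosed k] {n : ℕ} (hn : n - 1 < p)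
    {U M : NonprojIndec k p} (hU : U ∈ states k p) (h : 0 < U.tensorMultiplicity n M) :
    M ∈ states k p := by
  obtain ⟨d, hd, rfl⟩ := exists_eq_ofForms hU
  obtain ⟨f⟩ := nonempty_ofForms_rep_equiv (k := k) hd
  rw [tensorMultiplicity_pos_iff] at h
  obtain ⟨e, he, ⟨g⟩⟩ := hasSimpleSummands_tprod (k := k) (p := p) (m := d) (by omega) hn M.rep
    inferInstance M.isIndecomposable_rep M.not_isTraceProjective_rep
    (h.trans (f.isSummand.tensor (.refl _)))
  rw [eq_ofForms he g]
  exact ofForms_mem_states he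

end NonprojIndec

end States

end

/-! ### Positivity of multi-step transition probabilities -/

section Markov

variable {α : Type u} {P : α → α → ℝ}

theorem stepProb_nonneg (hP : ∀ x y, 0 ≤ P x y) (t : ℕ) (x y : α) : 0 ≤ stepProb P t x y := by
  induction t generalizing x with
  | zero => rw [stepProb]; split_ifs <;> norm_num
  | succ t ih => exact tsum_nonneg fun z => mul_nonneg (hP x z) (ih z)

theorem stepProb_zero_pos_iff {x y : α} : 0 < stepProb P 0 x y ↔ x = y := by
  rw [stepProb]; split_ifs with h <;> simp [h]

theorem stepProb_succ_pos_iff [Finite α] (hP : ∀ x y, 0 ≤ P x y) {t : ℕ} {x z : α} :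
    0 < stepProb P (t + 1) x z ↔ ∃ y, 0 < P x y ∧ 0 < stepProb P t y z := by
  have := Fintype.ofFinite α
  have hn : ∀ y ∈ Finset.univ, 0 ≤ P x y * stepProb P t y z :=
    fun y _ => mul_nonneg (hP x y) (stepProb_nonneg hP t y z)
  rw [stepProb, tsum_fintype, (Finset.sum_nonneg hn).lt_iff_ne, ne_comm, Ne,
    Finset.sum_eq_zero_iff_of_nonneg hn]
  push Not
  simp only [Finset.mem_univ, true_and, mul_ne_zero_iff, ← (hP x _).lt_iff_ne',
    ← (stepProb_nonneg hP t _ z).lt_iff_ne']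

theorem stepProb_one_pos [Finite α] (hP : ∀ x y, 0 ≤ P x y) {x y : α} (h : 0 < P x y) :
    0 < stepProb P 1 x y :=
  (stepProb_succ_pos_iff hP).2 ⟨y, h, stepProb_zero_pos_iff.2 rfl⟩

theorem stepProb_add_pos [Finite α] (hP : ∀ x y, 0 ≤ P x y) {s t : ℕ} {x y z : α}
    (h : 0 < stepProb P s x y) (h' : 0 < stepProb P t y z) : 0 < stepProb P (s + t) x z := by
  induction s generalizing x with
  | zero => rwa [stepProb_zero_pos_iff.1 h, zero_add]
  | succ s ih =>
    obtain ⟨a, h1, h2⟩ := (stepProb_succ_pos_iff hP).1 h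
    rw [Nat.add_right_comm]
    exact (stepProb_succ_pos_iff hP).2 ⟨a, h1, ih h2⟩

theorem iff_of_stepProb_pos [Finite α] (hP : ∀ x y, 0 ≤ P x y) {A : α → Prop}
    (hA : ∀ x y, 0 < P x y → (A x ↔ A y)) {t : ℕ} {x y : α} (h : 0 < stepProb P t x y) :
    A x ↔ A y := by
  induction t generalizing x with
  | zero => rw [stepProb_zero_pos_iff.1 h]
  | succ t ih =>
    obtain ⟨a, h1, h2⟩ := (stepProb_succ_pos_iff hP).1 h
    exact (hA _ _ h1).trans (ih h2)

theorem even_iff_of_stepProb_pos [Finite α] (hP : ∀ x y, 0 ≤ P x y) {A : α → Prop}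
    (hA : ∀ x y, 0 < P x y → (A x ↔ ¬ A y)) {t : ℕ} {x y : α} (h : 0 < stepProb P t x y) :
    Even t ↔ (A x ↔ A y) := by
  induction t generalizing x with
  | zero => simp [stepProb_zero_pos_iff.1 h]
  | succ t ih =>
    obtain ⟨a, h1, h2⟩ := (stepProb_succ_pos_iff hP).1 h
    have := hA _ _ h1
    have := ih h2
    rw [Nat.even_add_one]
    tauto

theorem period_eq {x : α} {d : ℕ} (hd : 0 < d)
    (h : ∀ t, 1 ≤ t → 0 < stepProb P t x x → d ∣ t)
    (h' : ∀ e, (∀ t, 1 ≤ t → 0 < stepProb P t x x → e ∣ t) → e ∣ d) : period P x = d :=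
  IsGreatest.csSup_eq ⟨h, fun e he => Nat.le_of_dvd hd (h' e he)⟩

end Markov

/-! ### The transition matrix of the walk -/

section Transition

variable {k : Type u} [Field k] {p : ℕ} [CharP k p] {n : ℕ} {w : NonprojIndec k p → ℝ}

open NonprojIndec

theorem transition_nonneg (hw : ∀ M, 0 < w M) (U M : NonprojIndec k p) :
    0 ≤ transition n w U M :=
  div_nonneg (mul_nonneg (hw M).le (Nat.cast_nonneg _))
    (finsum_nonneg fun L => mul_nonneg (hw L).le (Nat.cast_nonneg _))

theorem mem_of_transition_pos {S : Set (NonprojIndec k p)}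
    (hC : IsChainOn (transition n w) S) {U M : NonprojIndec k p}
    (hU : U ∈ S) (h : 0 < transition n w U M) : M ∈ S := by
  by_contra hM
  exact h.ne' (hC.closed U hU M hM)

theorem restrict_nonneg {S : Set (NonprojIndec k p)} (hw : ∀ M, 0 < w M)
    (x y : S) : 0 ≤ restrict (transition n w) S x y :=
  transition_nonneg hw _ _

variable [Fact p.Prime]

theorem isSummand_tensor_tensor_self {m d : ℕ} (hm : m + 1 < p) :
    IsSummand (formRep k p d) ((formRep k p d).tprod ((formRep k p m).tprod (formRep k p m))) := by
  obtain ⟨e⟩ := nonempty_equiv_tensor_zero (formRep k p d)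
  exact e.isSummand.trans ((IsSummand.refl _).tensor (isSummand_formRep_zero hm))

variable (n w) in
/-- The forms of degree `e` can be reached from those of degree `d` in an even number of steps. -/
def EvenReach (S : Set (NonprojIndec k p)) (d e : ℕ) : Prop :=
  ∃ (hd : d + 1 < p) (he : e + 1 < p) (hd' : ofForms k d hd ∈ S) (he' : ofForms k e he ∈ S) (t : ℕ),
    Even t ∧ 0 < stepProb (restrict (transition n w) S) t ⟨_, hd'⟩ ⟨_, he'⟩

theorem evenReach_refl {S : Set (NonprojIndec k p)} {d : ℕ} (hd : d + 1 < p)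
    (hd' : ofForms k d hd ∈ S) : EvenReach n w S d d :=
  ⟨hd, hd, hd', hd', 0, Even.zero, stepProb_zero_pos_iff.2 rfl⟩

variable [IsAlgClosed k]

/-- Finite support makes the normalising `finsum` a genuine sum and not the default value 0. -/
theorem support_subset_states (hnp : n - 1 < p) {U : NonprojIndec k p} (hU : U ∈ states k p) :
    (Function.support fun L => w L * (U.tensorMultiplicity n L : ℝ)) ⊆
      (finite_states (k := k) (p := p)).toFinset := by
  intro L hL
  rw [Set.Finite.coe_toFinset]
  refine mem_states_of_tensorMultiplicity_pos hnp hU (Nat.pos_of_ne_zero fun h => hL ?_)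
  simp [h]

theorem finsum_weight_pos (hw : ∀ M, 0 < w M) (hnp : n - 1 < p) {U M : NonprojIndec k p}
    (hU : U ∈ states k p) (h : 0 < U.tensorMultiplicity n M) :
    0 < ∑ᶠ L, w L * (U.tensorMultiplicity n L : ℝ) := by
  rw [finsum_eq_sum_of_support_subset _ (support_subset_states hnp hU)]
  refine Finset.sum_pos' (fun L _ => mul_nonneg (hw L).le (Nat.cast_nonneg _)) ⟨M, ?_, ?_⟩
  · rw [Set.Finite.mem_toFinset]
    exact mem_states_of_tensorMultiplicity_pos hnp hU h
  · exact mul_pos (hw M) (Nat.cast_pos.2 h)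

theorem transition_pos_iff (hw : ∀ M, 0 < w M) (hnp : n - 1 < p) {U M : NonprojIndec k p}
    (hU : U ∈ states k p) : 0 < transition n w U M ↔ 0 < U.tensorMultiplicity n M := by
  constructor
  · intro h
    refine Nat.pos_of_ne_zero fun h0 => h.ne' ?_
    simp [transition, h0]
  · exact fun h => div_pos (mul_pos (hw M) (Nat.cast_pos.2 h)) (finsum_weight_pos hw hnp hU h)

theorem exists_two_steps (hw : ∀ M, 0 < w M) (hnp : n - 1 < p) {d e : ℕ} (hd : d + 1 < p)
    (he : e + 1 < p) (h : IsSummand (formRep k p e)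
      ((formRep k p d).tprod ((formRep k p (n - 1)).tprod (formRep k p (n - 1))))) :
    ∃ l, ∃ hl : l + 1 < p, 0 < transition n w (ofForms k d hd) (ofForms k l hl) ∧
      0 < transition n w (ofForms k l hl) (ofForms k e he) := by
  obtain ⟨l, hl, h1, h2⟩ := exists_common_summand (by omega) hnp he h
  exact ⟨l, hl, (transition_pos_iff hw hnp (ofForms_mem_states hd)).2
    ((tensorMultiplicity_ofForms_pos_iff n hd hl).2 h1),
    (transition_pos_iff hw hnp (ofForms_mem_states hl)).2
    ((tensorMultiplicity_ofForms_pos_iff n hl he).2 h2)⟩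

theorem exists_transition_pos (hw : ∀ M, 0 < w M) (hnp : n - 1 + 1 < p) {U : NonprojIndec k p}
    (hU : U ∈ states k p) : ∃ M, 0 < transition n w U M := by
  obtain ⟨d, hd, rfl⟩ := exists_eq_ofForms hU
  obtain ⟨l, hl, h, -⟩ := exists_two_steps hw (by omega) hd hd (isSummand_tensor_tensor_self hnp)
  exact ⟨_, h⟩

theorem isChainOn_of_subset (hw : ∀ M, 0 < w M) (hnp : n - 1 + 1 < p) {S : Set (NonprojIndec k p)}
    (hS : S ⊆ states k p)
    (h : ∀ x ∈ S, ∀ y ∈ states k p, 0 < transition n w x y → y ∈ S) :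
    IsChainOn (transition n w) S where
  nonneg x _ y := transition_nonneg hw x y
  hasSum x hx := by
    obtain ⟨M, hM⟩ := exists_transition_pos hw hnp (hS hx)
    have hpos := finsum_weight_pos hw (by omega) (hS hx)
      ((transition_pos_iff hw (by omega) (hS hx)).1 hM)
    have hsub := support_subset_states (w := w) (n := n) (by omega) (hS hx)
    have h1 : HasSum (fun L => w L * (x.tensorMultiplicity n L : ℝ))
        (∑ᶠ L, w L * (x.tensorMultiplicity n L : ℝ)) := by
      rw [finsum_eq_sum_of_support_subset _ hsub]
      exact hasSum_sum_of_ne_finset_zero fun L hL => by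
        by_contra h0
        exact hL (hsub h0)
    have h2 := h1.div_const (∑ᶠ L, w L * (x.tensorMultiplicity n L : ℝ))
    rwa [div_self hpos.ne'] at h2
  closed x hx y hy := by
    by_contra h0
    have hpos := (transition_nonneg (n := n) hw x y).lt_of_ne' h0
    exact hy (h x hx y (mem_states_of_tensorMultiplicity_pos (by omega) (hS hx)
      ((transition_pos_iff hw (by omega) (hS hx)).1 hpos)) hpos)

/-- Dimensions exceed degrees by one on both sides, so the parity rule for degrees carries over. -/
theorem even_dim_iff (hw : ∀ M, 0 < w M) (hnp : n - 1 < p) (hp : p ≠ 2) {U M : NonprojIndec k p}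
    (hU : U ∈ states k p) (h : 0 < transition n w U M) :
    Even M.dim ↔ Even (U.dim + (n - 1)) := by
  rw [transition_pos_iff hw hnp hU] at h
  obtain ⟨d, hd, rfl⟩ := exists_eq_ofForms hU
  obtain ⟨e, he, rfl⟩ := exists_eq_ofForms (mem_states_of_tensorMultiplicity_pos hnp hU h)
  rw [tensorMultiplicity_ofForms_pos_iff] at h
  have := even_iff_of_isSummand hp h
  rw [dim_ofForms, dim_ofForms, Nat.even_add_one, this, Nat.add_right_comm, Nat.even_add_one]

/-! ### Reachability in an even number of steps -/

section Reach

variable {S : Set (NonprojIndec k p)}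

theorem finite_of_subset_states (hS : S ⊆ states k p) : Finite S :=
  (finite_states.subset hS).to_subtype

theorem EvenReach.trans (hw : ∀ M, 0 < w M) (hS : S ⊆ states k p) {a b c : ℕ}
    (h : EvenReach n w S a b) (h' : EvenReach n w S b c) : EvenReach n w S a c := by
  have := finite_of_subset_states hS
  obtain ⟨h1, h2, h3, h4, s, h5, h6⟩ := h
  obtain ⟨_, i2, _, i4, t, i5, i6⟩ := h'
  exact ⟨h1, i2, h3, i4, s + t, h5.add i5, stepProb_add_pos (restrict_nonneg hw) h6 i6⟩

theorem stepProb_two_pos (hw : ∀ M, 0 < w M) (hnp : n - 1 < p) (hS : S ⊆ states k p)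
    (hC : IsChainOn (transition n w) S)
    {d e : ℕ} (hd : d + 1 < p) (he : e + 1 < p) (h : IsSummand (formRep k p e)
      ((formRep k p d).tprod ((formRep k p (n - 1)).tprod (formRep k p (n - 1)))))
    (hd' : ofForms k d hd ∈ S) :
    ∃ he' : ofForms k e he ∈ S,
      0 < stepProb (restrict (transition n w) S) 2 ⟨_, hd'⟩ ⟨_, he'⟩ := by
  have := finite_of_subset_states hS
  obtain ⟨l, hl, h1, h2⟩ := exists_two_steps hw hnp hd he h
  have hl' := mem_of_transition_pos hC hd' h1
  have he' := mem_of_transition_pos hC hl' h2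
  refine ⟨he', (stepProb_succ_pos_iff (restrict_nonneg hw)).2 ⟨⟨_, hl'⟩, h1, ?_⟩⟩
  exact stepProb_one_pos (restrict_nonneg hw) h2

theorem stepProb_two_self_pos (hw : ∀ M, 0 < w M) (hnp : n - 1 + 1 < p) (hS : S ⊆ states k p)
    (hC : IsChainOn (transition n w) S) (x : S) :
    0 < stepProb (restrict (transition n w) S) 2 x x := by
  obtain ⟨x, hx⟩ := x
  obtain ⟨d, hd, rfl⟩ := exists_eq_ofForms (hS hx)
  exact (stepProb_two_pos hw (by omega) hS hC hd hd (isSummand_tensor_tensor_self hnp) hx).2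

theorem evenReach_up (hw : ∀ M, 0 < w M) (hn : 2 ≤ n) (hnp : n + 1 < p) (hS : S ⊆ states k p)
    (hC : IsChainOn (transition n w) S) {d : ℕ} (hd : d + 3 < p)
    (hd' : ofForms k d (by omega) ∈ S) : EvenReach n w S d (d + 2) := by
  obtain ⟨m, rfl⟩ : ∃ m, n = m + 2 := ⟨n - 2, by omega⟩
  obtain ⟨h1, h2⟩ := stepProb_two_pos hw (by omega) hS hC (by omega) hd
    ((isSummand_tensor_two_up hd).trans ((IsSummand.refl _).tensor
      (isSummand_formRep_two (n := m) (by omega)))) hd'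
  exact ⟨_, _, _, h1, 2, even_two, h2⟩

theorem evenReach_down (hw : ∀ M, 0 < w M) (hn : 2 ≤ n) (hnp : n + 1 < p) (hS : S ⊆ states k p)
    (hC : IsChainOn (transition n w) S) {d : ℕ} (hd : d + 3 < p)
    (hd' : ofForms k (d + 2) hd ∈ S) : EvenReach n w S (d + 2) d := by
  obtain ⟨m, rfl⟩ : ∃ m, n = m + 2 := ⟨n - 2, by omega⟩
  obtain ⟨h1, h2⟩ := stepProb_two_pos hw (by omega) hS hC hd (by omega)
    ((isSummand_tensor_two_down hd).trans ((IsSummand.refl _).tensor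
      (isSummand_formRep_two (n := m) (by omega)))) hd'
  exact ⟨_, _, _, h1, 2, even_two, h2⟩

/-- Membership in S is assumed only at the starting point, since the chain being closed on S
propagates it along the ladder of steps ± 2. -/
theorem evenReach_add (hw : ∀ M, 0 < w M) (hn : 2 ≤ n) (hnp : n + 1 < p) (hS : S ⊆ states k p)
    (hC : IsChainOn (transition n w) S) (d j : ℕ) (hd : d + 2 * j + 1 < p) :
    (ofForms k d (by omega) ∈ S → EvenReach n w S d (d + 2 * j)) ∧
    (ofForms k (d + 2 * j) hd ∈ S → EvenReach n w S (d + 2 * j) d) := by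
  induction j with
  | zero => exact ⟨fun h => evenReach_refl _ h, fun h => evenReach_refl _ h⟩
  | succ j ih =>
    obtain ⟨i1, i2⟩ := ih (by omega)
    constructor
    · intro h
      have h1 := i1 h
      obtain ⟨_, _, _, h2, -⟩ := id h1
      exact h1.trans hw hS (evenReach_up hw hn hnp hS hC hd h2)
    · intro h
      have h1 := evenReach_down hw hn hnp hS hC (d := d + 2 * j) hd h
      obtain ⟨_, _, _, h2, -⟩ := id h1
      exact h1.trans hw hS (i2 h2)

theorem exists_even_stepProb_pos (hw : ∀ M, 0 < w M) (hn : 2 ≤ n) (hnp : n + 1 < p)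
    (hS : S ⊆ states k p) (hC : IsChainOn (transition n w) S) (x y : S)
    (hxy : Even x.1.dim ↔ Even y.1.dim) :
    ∃ t, Even t ∧ 0 < stepProb (restrict (transition n w) S) t x y := by
  obtain ⟨x, hx⟩ := x
  obtain ⟨y, hy⟩ := y
  obtain ⟨d, hd, rfl⟩ := exists_eq_ofForms (hS hx)
  obtain ⟨e, he, rfl⟩ := exists_eq_ofForms (hS hy)
  simp only [dim_ofForms, Nat.even_add_one, not_iff_not] at hxy
  have : EvenReach n w S d e := by
    rcases le_total d e with h | h
    · obtain ⟨j, rfl⟩ : ∃ j, e = d + 2 * j := ⟨(e - d) / 2, by grind⟩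
      exact (evenReach_add hw hn hnp hS hC d j he).1 hx
    · obtain ⟨j, rfl⟩ : ∃ j, d = e + 2 * j := ⟨(d - e) / 2, by grind⟩
      exact (evenReach_add hw hn hnp hS hC e j hd).2 hx
  obtain ⟨_, _, _, _, t, ht, h⟩ := this
  exact ⟨t, ht, h⟩

theorem isIrreducible_of_same_parity (hw : ∀ M, 0 < w M) (hn : 2 ≤ n) (hnp : n + 1 < p)
    (hS : S ⊆ states k p) (hC : IsChainOn (transition n w) S) (hne : S.Nonempty)
    (hpar : ∀ x y : S, Even x.1.dim ↔ Even y.1.dim) :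
    IsIrreducible (restrict (transition n w) S) := by
  refine ⟨hne.to_subtype, fun x y => ?_⟩
  obtain ⟨t, -, h⟩ := exists_even_stepProb_pos hw hn hnp hS hC x y (hpar x y)
  exact ⟨t, h⟩

/-- There is a return in 2 steps. Any step out can be followed by an even path back, since all
states have the same parity; this odd return forces the period to be 1. -/
theorem isAperiodic_of_same_parity (hw : ∀ M, 0 < w M) (hn : 2 ≤ n) (hnp : n + 1 < p)
    (hS : S ⊆ states k p) (hC : IsChainOn (transition n w) S)
    (hpar : ∀ x y : S, Even x.1.dim ↔ Even y.1.dim) :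
    IsAperiodic (restrict (transition n w) S) := by
  have := finite_of_subset_states hS
  intro x
  refine period_eq one_pos (fun t _ _ => one_dvd t) fun e he => ?_
  have h2 := he 2 one_le_two (stepProb_two_self_pos hw (by omega) hS hC x)
  obtain ⟨y, hy⟩ := exists_transition_pos hw (n := n) (by omega) (hS x.2)
  obtain ⟨t, ht, h⟩ := exists_even_stepProb_pos hw hn hnp hS hC
    ⟨y, mem_of_transition_pos hC x.2 hy⟩ x (hpar _ _)
  have h3 := he (t + 1) (by omega)
    ((stepProb_succ_pos_iff (restrict_nonneg hw)).2 ⟨⟨y, mem_of_transition_pos hC x.2 hy⟩, hy, h⟩)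
  exact (Nat.dvd_add_right (h2.trans ht.two_dvd)).1 h3

end Reach

end Transition

end SL2Walk

end

open SL2Walk SL2Walk.NonprojIndec in
theorem proposition5p4 {k : Type u} [Field k] [IsAlgClosed k] {p : ℕ} [Fact p.Prime] [CharP k p]
    (n : ℕ) (hn : 2 ≤ n) (hnp : n ≤ p - 2)
    (w : SL2Walk.NonprojIndec k p → ℝ) (hw : ∀ M, 0 < w M) :
    SL2Walk.IsChainOn (SL2Walk.transition n w) (SL2Walk.states k p) ∧
    (Odd n →
      ¬ SL2Walk.IsIrreducible
          (SL2Walk.restrict (SL2Walk.transition n w) (SL2Walk.states k p)) ∧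
      (SL2Walk.IsChainOn (SL2Walk.transition n w) (SL2Walk.evenStates k p) ∧
        SL2Walk.IsIrreducible
          (SL2Walk.restrict (SL2Walk.transition n w) (SL2Walk.evenStates k p)) ∧
        SL2Walk.IsAperiodic
          (SL2Walk.restrict (SL2Walk.transition n w) (SL2Walk.evenStates k p))) ∧
      (SL2Walk.IsChainOn (SL2Walk.transition n w) (SL2Walk.oddStates k p) ∧
        SL2Walk.IsIrreducible
          (SL2Walk.restrict (SL2Walk.transition n w) (SL2Walk.oddStates k p)) ∧
        SL2Walk.IsAperiodic
          (SL2Walk.restrict (SL2Walk.transition n w) (SL2Walk.oddStates k p)))) ∧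
    (Even n →
      SL2Walk.IsIrreducible
        (SL2Walk.restrict (SL2Walk.transition n w) (SL2Walk.states k p)) ∧
      SL2Walk.HasPeriod
        (SL2Walk.restrict (SL2Walk.transition n w) (SL2Walk.states k p)) 2) := by
  have hp2 : p ≠ 2 := by omega
  have hlt : n + 1 < p := by omega
  have hC : IsChainOn (transition n w) (states k p) :=
    isChainOn_of_subset hw (by omega) subset_rfl fun _ _ _ h _ => h
  have hfin : Finite (states k p) := finite_of_subset_states subset_rfl
  have h0 : ofForms k (p := p) 0 (by omega) ∈ states k p := ofForms_mem_states _
  have h1 : ofForms k (p := p) 1 (by omega) ∈ states k p := ofForms_mem_states _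
  -- A step preserves parity for odd n and reverses it for even n.
  have hpar : ∀ U ∈ states k p, ∀ M, 0 < transition n w U M →
      (Even M.dim ↔ (Even U.dim ↔ Odd n)) := by
    intro U hU M h
    rw [even_dim_iff hw (by omega) hp2 hU h, Nat.even_add, Nat.even_sub (by omega),
      ← Nat.not_even_iff_odd]
    simp
  refine ⟨hC, fun hodd => ⟨?_, ?_, ?_⟩, fun heven => ⟨⟨⟨⟨_, h0⟩⟩, ?_⟩, ?_⟩⟩
  · rintro ⟨-, h⟩
    -- These states have dimensions 1 and 2, so no parity-preserving path joins them.
    obtain ⟨t, ht⟩ := h ⟨_, h0⟩ ⟨_, h1⟩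
    have := iff_of_stepProb_pos (restrict_nonneg hw) (A := fun x => Even x.1.dim)
      (fun x y h => by simpa [hodd, iff_comm] using hpar x.1 x.2 y.1 h) ht
    simp [dim_ofForms] at this
  · have hS : evenStates k p ⊆ states k p := fun _ h => h.1
    have hE : IsChainOn (transition n w) (evenStates k p) :=
      isChainOn_of_subset hw (by omega) hS fun x hx y hy h =>
        ⟨hy, (hpar x (hS hx) y h).2 (iff_of_true hx.2 hodd)⟩
    have hsame : ∀ x y : evenStates k p, Even x.1.dim ↔ Even y.1.dim :=
      fun x y => iff_of_true x.2.2 y.2.2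
    exact ⟨hE, isIrreducible_of_same_parity hw hn hlt hS hE
      ⟨_, h1, by rw [dim_ofForms]; exact even_two⟩ hsame,
      isAperiodic_of_same_parity hw hn hlt hS hE hsame⟩
  · have hS : oddStates k p ⊆ states k p := fun _ h => h.1
    have hO : IsChainOn (transition n w) (oddStates k p) :=
      isChainOn_of_subset hw (by omega) hS fun x hx y hy h =>
        ⟨hy, by
          have h2 := hpar x (hS hx) y h
          have h3 := Nat.not_even_iff_odd.2 hx.2
          rw [← Nat.not_even_iff_odd]
          tauto⟩
    have hsame : ∀ x y : oddStates k p, Even x.1.dim ↔ Even y.1.dim :=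
      fun x y => iff_of_false (Nat.not_even_iff_odd.2 x.2.2) (Nat.not_even_iff_odd.2 y.2.2)
    exact ⟨hO, isIrreducible_of_same_parity hw hn hlt hS hO
      ⟨_, h0, by rw [dim_ofForms]; exact odd_one⟩ hsame,
      isAperiodic_of_same_parity hw hn hlt hS hO hsame⟩
  · intro x y
    by_cases hxy : Even x.1.dim ↔ Even y.1.dim
    · obtain ⟨t, -, h⟩ := exists_even_stepProb_pos hw hn hlt subset_rfl hC x y hxy
      exact ⟨t, h⟩
    -- One step brings the parity into agreement with that of y, after which an even path exists.
    · obtain ⟨z, hz⟩ := exists_transition_pos hw (n := n) (by omega) x.2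
      have h2 := hpar x.1 x.2 z hz
      have h3 := Nat.not_odd_iff_even.2 heven
      obtain ⟨t, -, h⟩ := exists_even_stepProb_pos hw hn hlt subset_rfl hC
        ⟨z, mem_of_transition_pos hC x.2 hz⟩ y (by
          change Even z.dim ↔ _
          tauto)
      exact ⟨t + 1, (stepProb_succ_pos_iff (restrict_nonneg hw)).2
        ⟨⟨z, mem_of_transition_pos hC x.2 hz⟩, hz, h⟩⟩
  · intro x
    -- Alternating parity makes every return time even, and a return in exactly 2 steps is possible.
    refine period_eq two_pos (fun t _ ht => ?_) fun e he =>
      he 2 one_le_two (stepProb_two_self_pos hw (by omega) subset_rfl hC x)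
    refine ((even_iff_of_stepProb_pos (restrict_nonneg hw) (A := fun x => Even x.1.dim)
      (fun x y h => ?_) ht).2 Iff.rfl).two_dvd
    have h2 := hpar x.1 x.2 y.1 h
    have h3 := Nat.not_odd_iff_even.2 heven
    tauto
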